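/- Let $q$ be a power of an odd prime and let $\mathrm{Tr}(x)=x+x^q$ be the relative trace $\mathbb F_{q^2}\to\mathbb F_q$. On $\mathbb F_{q^2}^3$ consider the quadratic form $B(X,Y,Z)=XY+Z^2$, and let $H=\Omega_3(q^2)$ be the derived subgroup of the isometry group of $B$. Let $\Pi=\mathrm{PG}(2,q^2)$ and view $\mathbb F_{q^2}^3$ also as a $6$-dimensional $\mathbb F_q$-space with projective space $\mathrm{PG}(5,q)$. For $\nu\in\mathbb F_{q^2}^*$ let $Q_\nu(v)=\mathrm{Tr}(\nu B(v))$, a quadratic form over $\mathbb F_q$ on this $6$-dimensional space. (1) The conic $\mathcal C$ of $\Pi$ with equation $B=0$ is $\{(0:1:0)\}\cup\{(1:-t^2:t)\mid t\in\mathbb F_{q^2}\}$. (2) For $\varepsilon\in\mathbb F_{q^2}$, every line of $\Pi$ through $(1:1:\varepsilon)$ meets $\mathcal C$ in $0$ or $2$ points if and only if $\varepsilon^2+1$ is not a square in $\mathbb F_{q^2}$. Some $\varepsilon\in\mathbb F_{q^2}^*$ has this property. (3) Let $\varepsilon^2+1$ be a non-square in $\mathbb F_{q^2}$. In $\Pi$,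 the $H$-orbit of $(1:0:0)$ is $\mathcal C$, and the $H$-orbit of $(1:1:\varepsilon)$ is the set of all points whose lines all meet $\mathcal C$ in $0$ or $2$ points. There is $\nu\in\mathbb F_{q^2}^*$ with $Q_\nu(1,1,\varepsilon)=0$, and for every such $\nu$ the following hold. (a) $Q_\nu$ is $H$-invariant and is a nondegenerate quadratic form of minus type (Witt index $2$). (b) Let $V$ be the union of the $H$-orbits of the points $(1:0:0)$ and $(1:1:\varepsilon)$ of $\mathrm{PG}(5,q)$. Then $V$ is a Cossidente–Penttila hemisystem, that is, an $H$-invariant set that consists of half of the points of the quadric $Q_\nu=0$ and contains exactly $(q+1)/2$ points of each line that lies on the quadric. (c) Let $\Gamma$ be the graph on $V$ in which two distinct points are adjacent if the line joining them lies on the quadric $Q_\nu=0$ (the subgraph induced on $V$ by the collinearity graph of the generalized quadrangle of the quadric). Then $\Gamma$ is strongly regular with parameters $$\left(\frac{(q^3+1)(q+1)}2,\ \frac{(q^2+1)(q-1)}2,\ \frac{q-3}2,\ \frac{(q-1)^2}2\right).$$ -/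

import Mathlib

open scoped LinearAlgebra.Projectivization

noncomputable section

namespace CPHemisystem

section Quadrics

variable {k V : Type*} [Field k] [AddCommGroup V] [Module k V]

/-- A subspace on which the quadratic form `Q` vanishes identically. -/
def IsTotallySingular (Q : QuadraticForm k V) (L : Submodule k V) : Prop :=
  ∀ v ∈ L, Q v = 0

/-- The quadric `Q = 0` in the projective space of `V`. -/
def quadric (Q : QuadraticForm k V) : Set (ℙ k V) :=
  {p | IsTotallySingular Q p.submodule}

/-- The points of a projective line, plane, etc. given as a linear subspace. -/
def pointsOn (L : Submodule k V) : Set (ℙ k V) :=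
  {p | p.submodule ≤ L}

/-- Lines of the projective space of `V`: linear subspaces of dimension two. -/
def IsLine (L : Submodule k V) : Prop :=
  Module.finrank k L = 2

/-- Quadratic forms of minus type in even dimension `2 (n + 1)`: nondegenerate, with
maximal totally singular subspaces of dimension `n`. -/
def IsMinusType (Q : QuadraticForm k V) : Prop :=
  Q.polarBilin.Nondegenerate ∧
    ∃ n : ℕ, Module.finrank k V = 2 * (n + 1) ∧
      (∃ L : Submodule k V, Module.finrank k L = n ∧ IsTotallySingular Q L) ∧
      ∀ L : Submodule k V, IsTotallySingular Q L → Module.finrank k L ≤ n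

/-- The isometry group of a quadratic form. -/
def orthogonalGroup (Q : QuadraticForm k V) : Subgroup (V ≃ₗ[k] V) where
  carrier := {g | ∀ v, Q (g v) = Q v}
  mul_mem' {g h} hg hh v := (hg (h v)).trans (hh v)
  one_mem' _ := rfl
  inv_mem' {g} hg v := by
    have h := hg (g⁻¹ v)
    rw [← LinearEquiv.mul_apply, mul_inv_cancel] at h
    exact h.symm

/-- Collinearity on a quadric: two distinct points are adjacent if the line that joins them
lies on the quadric (so points off the quadric are isolated). -/
def collinearityGraph (Q : QuadraticForm k V) : SimpleGraph (ℙ k V) where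
  Adj p r := p ≠ r ∧ IsTotallySingular Q (p.submodule ⊔ r.submodule)
  symm := ⟨fun p r h => ⟨h.1.symm, by rw [sup_comm]; exact h.2⟩⟩
  loopless := ⟨fun _ h => h.1 rfl⟩

/-- A hemisystem of points of a quadric: a set `S` of points of the quadric that contains half of
the `q + 1` points of every line on the quadric, and half of all its points
(`q` is the number of elements of the field). -/
structure IsHemisystem (Q : QuadraticForm k V) (S : Set (ℙ k V)) : Prop where
  subset : S ⊆ quadric Q
  half : (quadric Q \ S).ncard = S.ncard
  line : ∀ L : Submodule k V, IsLine L → IsTotallySingular Q L →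
    2 * (S ∩ pointsOn L).ncard = Nat.card k + 1

end Quadrics

section Plane

variable (K : Type*) [Field K]

/-- The ternary quadratic form `B(X, Y, Z) = X Y + Z ^ 2`. -/
def formB : QuadraticForm K (Fin 3 → K) :=
  QuadraticMap.proj 0 1 + QuadraticMap.proj 2 2

/-- The group `Ω₃`, the derived subgroup of the orthogonal group of `B`. -/
def omegaThree : Subgroup ((Fin 3 → K) ≃ₗ[K] (Fin 3 → K)) :=
  ⁅orthogonalGroup (formB K), orthogonalGroup (formB K)⁆

variable {K}

/-- The point `(1 : y : z)`. The scalars may come from a subfield `k` of `K`: for `k = K` this is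
a point of the projective plane over `K`, and otherwise it is a point of the projective space of
`K ^ 3` viewed as a vector space over `k`. -/
def point (k : Type*) [Field k] [Algebra k K] (y z : K) : ℙ k (Fin 3 → K) :=
  Projectivization.mk k ![1, y, z] fun h => one_ne_zero (α := K) (congrFun h 0)

variable (K)

/-- The set `{(0 : 1 : 0)} ∪ {(1 : -t ^ 2 : t)}` in the projective plane over `K`. -/
def conic : Set (ℙ K (Fin 3 → K)) :=
  {Projectivization.mk K ![0, 1, 0] fun h => one_ne_zero (α := K) (congrFun h 1)} ∪
    Set.range fun t : K => point K (-t ^ 2) t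

/-- The points all of whose lines meet the conic in zero or two points. -/
def evenPoints : Set (ℙ K (Fin 3 → K)) :=
  {p | ∀ L : Submodule K (Fin 3 → K), IsLine L → p ∈ pointsOn L →
    (conic K ∩ pointsOn L).ncard = 0 ∨ (conic K ∩ pointsOn L).ncard = 2}

end Plane

section Trace

variable (F : Type*) {K : Type*} [Field F] [Field K] [Algebra F K]

/-- The quadratic form `v ↦ Tr (ν B(v))` over `F` on `K ^ 3`, with the relative trace
`Tr : K → F`. -/
def traceForm (ν : K) : QuadraticForm F (Fin 3 → K) :=
  (Algebra.trace F K).compQuadraticMap' (ν • formB K)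

/-- A Cossidente–Penttila hemisystem: a hemisystem of the quadric of the minus type form
`Tr (ν B)` that is invariant under the group `Ω₃` of `B`. -/
structure IsCossidentePenttila (ν : K) (S : Set (ℙ F (Fin 3 → K))) : Prop where
  minus : IsMinusType (traceForm F ν)
  hemisystem : IsHemisystem (traceForm F ν) S
  invariant : ∀ g : omegaThree K, ∀ p ∈ S, g • p ∈ S

/-- The union of the orbits under `Ω₃` of the points `(1 : 0 : 0)` and `(1 : 1 : ε)` of the
projective space of `K ^ 3` over `F`. -/
def orbitUnion (ε : K) : Set (ℙ F (Fin 3 → K)) :=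
  MulAction.orbit (omegaThree K) (point F (0 : K) 0) ∪
    MulAction.orbit (omegaThree K) (point F 1 ε)

end Trace

/-- Strongly regular graphs with parameters `(n, k, l, m)`, where `0 < k < n - 1`. -/
def IsStronglyRegular {α : Type*} [Finite α] (G : SimpleGraph α) (n k l m : ℕ) : Prop :=
  letI := Fintype.ofFinite α
  letI := Classical.decRel G.Adj
  0 < k ∧ k + 1 < n ∧ G.IsSRGWith n k l m

end CPHemisystem

end

/-!
The points of `PG(5, q)` in the union `V` of the two orbits are described by vectors: with
`c = ε ^ 2 + 1`, the point of `v` belongs to `V` if and only if either `B v = 0` and `v` is a square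
multiple of some `(a ^ 2, -b ^ 2, a b)`, or `B v = c a ^ 2` with `a ∈ F` nonzero. Indeed `Ω₃`
contains the unipotent elements `upper`, `lower` and the squares in the torus as commutators, which
makes it transitive enough (`exists_omegaThree_of_tau`, `exists_omegaThree_of_formB_eq`), and it
preserves the square class `tau` of singular vectors: the polar form of two singular vectors has the
square class of the product of theirs, so each isometry multiplies `tau` by a sign
(`exists_sign_tau`), and commutators have sign one.

A line `L` of the quadric `Tr (ν B) = 0` is an `F`-plane on which `B` is `c` times a binary quadratic
form `f` over `F`. Since vectors on the tangents of the conic take square values under `B`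
(`isSquare_of_polar_eq_zero`), while `c` is a nonsquare and elements of `F` are squares in `K`, the
form `f` is anisotropic, or hyperbolic, or zero with `L` a one-dimensional `K`-space. In all three
cases half of the points of `L` belong to `V` (`IsTraceData.two_mul_ncard_line`): by a similitude of
`f` with nonsquare multiplier; because the two points of `L` on `B = 0` have different square classes;
and because half of the nonzero elements of `K` are squares. The same facts bound the Witt index of
`Tr (ν B)` by two (`IsTraceData.finrank_le_two`).

The remaining claims hold for every set `S` of points of an elliptic quadric in `PG(5, q)` that
contains half of the points of each line. Let `χ` be the function with value `1` on `S` and `-1` on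
the other points of the quadric. As `χ` sums to zero on each line, collecting the points collinear
with `x` along the `q ^ 2 + 1` lines through `x` shows that `χ` is an eigenvector of the collinearity
relation (`IsBalanced.perpSum_of_ne_zero`). This gives `∑ χ = 0`, so `S` contains half of all
points, and the valency of the graph on `S`. Adjacent points have their common neighbours on the line
that joins them, because the quadric contains no planes. For nonadjacent `x` and `y` the sum of `χ`
over the set `W` of points collinear with both is found by counting the pairs of `w ∈ W` and `z`
collinear with it, weighted by `χ z`, in two ways, since each `z` not collinear with `x` and `y` is
collinear with exactly `q + 1` points of `W` (`IsEllipticSix.sum_orthogonal_perpPair`,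
`IsBalanced.sum_perpPair`).

The counts rest on splitting off hyperbolic pairs `x`, `y`: on `a x + b y + e` the form takes the
value `a b + Q e`. They are carried out with vectors, each point being represented by `q - 1` of them.
-/

noncomputable section

namespace CPHemisystem
open QuadraticMap

/-! ### Hyperbolic pairs in quadratic spaces -/

section Splitting
open scoped Classical

variable {F E : Type*} [Field F] [AddCommGroup E] [Module F E]

/-- The vectors orthogonal to `x`. -/
def perp (Q : QuadraticForm F E) (x : E) : Submodule F E :=
  LinearMap.ker (Q.polarBilin x)

/-- The vectors orthogonal to both `x` and `y`. -/
def perpPair (Q : QuadraticForm F E) (x y : E) : Submodule F E :=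
  perp Q x ⊓ perp Q y

theorem mem_perp {Q : QuadraticForm F E} {x v : E} : v ∈ perp Q x ↔ polar Q x v = 0 := Iff.rfl

theorem mem_perpPair {Q : QuadraticForm F E} {x y v : E} :
    v ∈ perpPair Q x y ↔ polar Q x v = 0 ∧ polar Q y v = 0 := Iff.rfl

/-- The restriction of a quadratic form to a subspace. -/
abbrev restr (Q : QuadraticForm F E) (U : Submodule F E) : QuadraticForm F U :=
  Q.comp U.subtype

theorem polar_restr (Q : QuadraticForm F E) (U : Submodule F E) (v w : U) :
    polar (restr Q U) v w = polar Q (v : E) w := by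
  simp [polar, restr]

theorem map_add_eq (Q : QuadraticForm F E) (v w : E) : Q (v + w) = Q v + Q w + polar Q v w := by
  simp [polar]

theorem map_lin (Q : QuadraticForm F E) (v w : E) (a b : F) :
    Q (a • v + b • w) = a * a * Q v + b * b * Q w + a * b * polar Q v w := by
  rw [map_add_eq, QuadraticMap.map_smul, QuadraticMap.map_smul, polar_smul_left, polar_smul_right]
  simp only [smul_eq_mul]; ring

theorem polar_self_of_singular {Q : QuadraticForm F E} {x : E} (hx : Q x = 0) :
    polar Q x x = 0 := by
  rw [polar_self, hx, smul_zero]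

/-- The decomposition of a quadratic space by a hyperbolic pair. -/
def hyperbolicSplit (Q : QuadraticForm F E) {x y : E} (hx : Q x = 0) (hy : Q y = 0)
    (hxy : polar Q x y = 1) : (F × F × perpPair Q x y) ≃ E where
  toFun p := p.1 • x + p.2.1 • y + p.2.2
  invFun v := (polar Q y v, polar Q x v,
    ⟨v - polar Q y v • x - polar Q x v • y, by
      have hyx : polar Q y x = 1 := by rw [polar_comm, hxy]
      rw [mem_perpPair]
      simp [polar_sub_right, polar_smul_right, polar_self_of_singular hx,
        polar_self_of_singular hy, hxy, hyx]⟩)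
  left_inv := by
    rintro ⟨a, b, e, he⟩
    have hyx : polar Q y x = 1 := by rw [polar_comm, hxy]
    rw [mem_perpPair] at he
    have h1 : polar Q y (a • x + b • y + e) = a := by
      simp [polar_add_right, polar_smul_right, polar_self_of_singular hy, hyx, he]
    have h2 : polar Q x (a • x + b • y + e) = b := by
      simp [polar_add_right, polar_smul_right, polar_self_of_singular hx, hxy, he]
    simp only [h1, h2, Prod.mk.injEq, true_and, Subtype.mk.injEq]
    abel
  right_inv v := by
    simp only []
    abel

theorem map_hyperbolicSplit (Q : QuadraticForm F E) {x y : E} (hx : Q x = 0) (hy : Q y = 0)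
    (hxy : polar Q x y = 1) (a b : F) (e : perpPair Q x y) :
    Q (a • x + b • y + e) = a * b + Q e := by
  obtain ⟨e, he⟩ := e
  rw [mem_perpPair] at he
  rw [map_add_eq, map_lin, hx, hy, hxy, polar_add_left, polar_smul_left, polar_smul_left, he.1, he.2]
  simp

/-- The decomposition of a quadratic space by a nonsingular vector. -/
def nonsingularSplit (Q : QuadraticForm F E) {x : E} (hx : polar Q x x ≠ 0) :
    (F × perp Q x) ≃ E where
  toFun p := p.1 • x + p.2
  invFun v := (polar Q x v / polar Q x x, ⟨v - (polar Q x v / polar Q x x) • x, by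
      rw [mem_perp, polar_sub_right, polar_smul_right, smul_eq_mul, div_mul_cancel₀ _ hx,
        sub_self]⟩)
  left_inv := by
    rintro ⟨a, e, he⟩
    rw [mem_perp] at he
    have h1 : polar Q x (a • x + e) / polar Q x x = a := by
      rw [polar_add_right, polar_smul_right, he, add_zero, smul_eq_mul, mul_div_cancel_right₀ _ hx]
    simp only [h1, Prod.mk.injEq, true_and, Subtype.mk.injEq]
    abel
  right_inv v := by
    simp only []
    abel

theorem separatingLeft_perpPair {Q : QuadraticForm F E} (hQ : Q.polarBilin.SeparatingLeft)
    {x y : E} (hx : Q x = 0) (hy : Q y = 0) (hxy : polar Q x y = 1) :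
    (restr Q (perpPair Q x y)).polarBilin.SeparatingLeft := by
  rintro ⟨v, hv⟩ h
  have hv' := mem_perpPair.1 hv
  refine Subtype.ext (hQ v fun w => ?_)
  obtain ⟨⟨a, b, e⟩, rfl⟩ := (hyperbolicSplit Q hx hy hxy).surjective w
  have he := h e
  rw [polarBilin_apply_apply, polar_restr] at he
  change polar Q v (a • x + b • y + e) = 0
  rw [polar_add_right, polar_add_right, polar_smul_right, polar_smul_right, he, polar_comm _ v x,
    polar_comm _ v y, hv'.1, hv'.2]
  simp

theorem separatingLeft_perp {Q : QuadraticForm F E} (hQ : Q.polarBilin.SeparatingLeft)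
    {x : E} (hx : polar Q x x ≠ 0) :
    (restr Q (perp Q x)).polarBilin.SeparatingLeft := by
  rintro ⟨v, hv⟩ h
  have hv' := mem_perp.1 hv
  refine Subtype.ext (hQ v fun w => ?_)
  obtain ⟨⟨a, e⟩, rfl⟩ := (nonsingularSplit Q hx).surjective w
  have he := h e
  rw [polarBilin_apply_apply, polar_restr] at he
  change polar Q v (a • x + e) = 0
  rw [polar_add_right, polar_smul_right, he, polar_comm _ v x, hv']
  simp

/-- A singular vector and a vector that is not orthogonal to it span a hyperbolic pair. -/
theorem exists_hyperbolic_combination {Q : QuadraticForm F E} {x w : E} (hx : Q x = 0)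
    (hw : polar Q x w ≠ 0) :
    ∃ a b : F, Q (a • w + b • x) = 0 ∧ polar Q x (a • w + b • x) = 1 := by
  refine ⟨(polar Q x w)⁻¹, -((polar Q x w)⁻¹ * (polar Q x w)⁻¹ * Q w), ?_, ?_⟩
  · rw [map_lin, hx, polar_comm _ w x]
    field_simp
    ring
  · rw [polar_add_right, polar_smul_right, polar_smul_right, polar_self_of_singular hx]
    simp [hw]

/-- A nonzero singular vector of a nondegenerate quadratic space lies in a hyperbolic pair. -/
theorem exists_hyperbolic_partner {Q : QuadraticForm F E} (hQ : Q.polarBilin.SeparatingLeft)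
    {x : E} (hx0 : x ≠ 0) (hx : Q x = 0) : ∃ y, Q y = 0 ∧ polar Q x y = 1 := by
  have : ∃ w, polar Q x w ≠ 0 := by
    by_contra! h
    exact hx0 (hQ x h)
  obtain ⟨w, hw⟩ := this
  obtain ⟨a, b, h⟩ := exists_hyperbolic_combination hx hw
  exact ⟨_, h⟩

end Splitting

/-! ### Numbers of singular vectors over finite fields -/

section Counting
open scoped Classical

variable {F E : Type*} [Field F] [AddCommGroup E] [Module F E] [Fintype F] [Fintype E]

omit [Fintype F] in
theorem ringChar_ne_two_of_two_ne_zero (h2 : (2 : F) ≠ 0) :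
    ringChar F ≠ 2 := fun h => h2 (by
  have := ringChar.Nat.cast_ringChar (R := F)
  rw [h] at this; exact_mod_cast this)

/-- In odd characteristic, a diagonal binary form over a finite field represents everything. -/
theorem exists_diagonal_eq (h2 : (2 : F) ≠ 0) {a b : F} (ha : a ≠ 0) (hb : b ≠ 0) (c : F) :
    ∃ m n : F, a * m ^ 2 + b * n ^ 2 = c := by
  have hchar := ringChar_ne_two_of_two_ne_zero h2
  obtain ⟨m, n, h⟩ := FiniteField.exists_root_sum_quadratic
    (f := Polynomial.C a * Polynomial.X ^ 2 + Polynomial.C 0 * Polynomial.X + Polynomial.C (-c))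
    (g := Polynomial.C b * Polynomial.X ^ 2 + Polynomial.C 0 * Polynomial.X + Polynomial.C 0)
    (Polynomial.degree_quadratic ha) (Polynomial.degree_quadratic hb)
    (FiniteField.odd_card_of_char_ne_two hchar)
  refine ⟨m, n, ?_⟩
  simp at h
  linear_combination h

/-- A quadratic form in at least three variables over a finite field of odd characteristic
is isotropic. -/
theorem exists_singular (Q : QuadraticForm F E) (h2 : (2 : F) ≠ 0)
    (hc : Fintype.card F ^ 2 < Fintype.card E) : ∃ v, v ≠ 0 ∧ Q v = 0 := by
  have key (u v : E) : ∃ w, w ≠ 0 ∧ polar Q u w = 0 ∧ polar Q v w = 0 := by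
    obtain ⟨w, w', hne, h⟩ := Fintype.exists_ne_map_eq_of_card_lt
      (fun w => ((polar Q u w, polar Q v w) : F × F)) (by simpa [_root_.sq] using hc)
    rw [Prod.mk.injEq] at h
    exact ⟨w - w', sub_ne_zero.2 hne, by rw [polar_sub_right, h.1, sub_self],
      by rw [polar_sub_right, h.2, sub_self]⟩
  by_contra! hQ
  obtain ⟨u, hu, -⟩ := key 0 0
  obtain ⟨v, hv, huv, -⟩ := key u 0
  obtain ⟨w, hw, huw, hvw⟩ := key u v
  obtain ⟨m, n, h⟩ := exists_diagonal_eq h2 (hQ u hu) (hQ v hv) (-Q w)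
  refine hQ (m • u + n • v + w) ?_ ?_
  · intro h0
    have : polar Q w (m • u + n • v + w) = 0 := by rw [h0, polar_zero_right]
    rw [polar_add_right, polar_add_right, polar_smul_right, polar_smul_right, polar_comm _ w,
      polar_comm _ w, huw, hvw, polar_self] at this
    simp [h2] at this
    exact hQ w hw this
  · rw [map_add_eq, map_lin, polar_add_left, polar_smul_left, polar_smul_left, huv, huw, hvw]
    simp
    linear_combination h

/-- The number of singular vectors, the zero vector included. -/
def numSingular (Q : QuadraticForm F E) : ℤ := ∑ v : E, if Q v = 0 then 1 else 0

theorem sum_hyperbolicSplit {Q : QuadraticForm F E} {x y : E} (hx : Q x = 0) (hy : Q y = 0)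
    (hxy : polar Q x y = 1) (f : E → ℤ) :
    ∑ v, f v = ∑ e : perpPair Q x y, ∑ a : F, ∑ b : F, f (a • x + b • y + e) := by
  rw [← (hyperbolicSplit Q hx hy hxy).sum_comp, Fintype.sum_prod_type, Finset.sum_comm,
    Fintype.sum_prod_type, Finset.sum_comm]
  refine Finset.sum_congr rfl fun e _ => ?_
  rw [Finset.sum_comm]
  rfl

theorem card_perpPair {Q : QuadraticForm F E} {x y : E} (hx : Q x = 0) (hy : Q y = 0)
    (hxy : polar Q x y = 1) :
    Fintype.card E = Fintype.card F ^ 2 * Fintype.card (perpPair Q x y) := by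
  rw [← Fintype.card_congr (hyperbolicSplit Q hx hy hxy), Fintype.card_prod, Fintype.card_prod]
  ring

theorem card_perp {Q : QuadraticForm F E} {x : E} (hx : polar Q x x ≠ 0) :
    Fintype.card E = Fintype.card F * Fintype.card (perp Q x) := by
  rw [← Fintype.card_congr (nonsingularSplit Q hx), Fintype.card_prod]

/-- The number of points of the affine conic `a b = -c`. -/
theorem sum_mul_eq (c : F) : (∑ a : F, ∑ b : F, if a * b + c = 0 then 1 else 0 : ℤ) =
    if c = 0 then 2 * (Fintype.card F : ℤ) - 1 else (Fintype.card F : ℤ) - 1 := by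
  have h (a : F) : (∑ b : F, if a * b + c = 0 then 1 else 0 : ℤ) =
      if a = 0 then (if c = 0 then (Fintype.card F : ℤ) else 0) else 1 := by
    rcases eq_or_ne a 0 with rfl | ha
    · by_cases hc : c = 0 <;> simp [hc]
    · have (b : F) : a * b + c = 0 ↔ b = -c / a := by
        rw [eq_div_iff ha]; constructor <;> intro h <;> linear_combination h
      simp [this, ha]
  simp_rw [h]
  rw [← Finset.add_sum_erase _ _ (Finset.mem_univ (0 : F)), if_pos rfl,
    Finset.sum_congr rfl fun a ha => if_neg (Finset.ne_of_mem_erase ha)]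
  have : 1 ≤ Fintype.card F := Fintype.card_pos
  split_ifs <;> (simp [Finset.card_erase_of_mem, Nat.cast_sub this]; try ring)

/-- Removing a hyperbolic pair relates the numbers of singular vectors. -/
theorem numSingular_split {Q : QuadraticForm F E} {x y : E} (hx : Q x = 0) (hy : Q y = 0)
    (hxy : polar Q x y = 1) :
    numSingular Q = ((Fintype.card F : ℤ) - 1) * Fintype.card (perpPair Q x y) +
      Fintype.card F * numSingular (restr Q (perpPair Q x y)) := by
  rw [numSingular, sum_hyperbolicSplit hx hy hxy]
  simp_rw [map_hyperbolicSplit Q hx hy hxy, sum_mul_eq]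
  have h1 : (Fintype.card (perpPair Q x y) : ℤ) = ∑ _e : perpPair Q x y, 1 := by simp
  rw [numSingular, h1, Finset.mul_sum, Finset.mul_sum, ← Finset.sum_add_distrib]
  refine Finset.sum_congr rfl fun e _ => ?_
  by_cases h : Q e = 0
  · simp only [restr, QuadraticMap.comp_apply, Submodule.subtype_apply, h, if_true]; ring
  · simp [restr, h]

omit [Fintype F] in
theorem numSingular_of_anisotropic {Q : QuadraticForm F E} (h : ∀ v, Q v = 0 → v = 0) :
    numSingular Q = 1 := by
  have (v : E) : Q v = 0 ↔ v = 0 := ⟨h v, fun hv => by rw [hv, QuadraticMap.map_zero]⟩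
  simp [numSingular, this]

/-- A nondegenerate conic over a field of `q` elements has `q + 1` points. -/
theorem numSingular_ternary {Q : QuadraticForm F E} (h2 : (2 : F) ≠ 0)
    (hQ : Q.polarBilin.SeparatingLeft) (hE : Fintype.card E = Fintype.card F ^ 3) :
    numSingular Q = Fintype.card F ^ 2 := by
  have hF : 1 < Fintype.card F := Fintype.one_lt_card
  obtain ⟨x, hx0, hx⟩ := exists_singular Q h2
    (by rw [hE]; exact Nat.pow_lt_pow_right hF (by norm_num))
  obtain ⟨y, hy, hxy⟩ := exists_hyperbolic_partner hQ hx0 hx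
  have hc := card_perpPair hx hy hxy
  have hc' : Fintype.card (perpPair Q x y) = Fintype.card F := by
    rw [hE] at hc
    exact Nat.eq_of_mul_eq_mul_left (by positivity) (hc.symm.trans (by ring))
  rw [numSingular_split hx hy hxy, hc', numSingular_of_anisotropic]
  · ring
  · intro v hv
    by_contra hv0
    -- The complement of the hyperbolic pair would be spanned by one singular vector.
    obtain ⟨w, -, hvw⟩ := exists_hyperbolic_partner (separatingLeft_perpPair hQ hx hy hxy) hv0 hv
    have hinj : Function.Injective fun a : F => a • v := smul_left_injective F hv0
    obtain ⟨a, rfl⟩ := ((Fintype.bijective_iff_injective_and_card _).2 ⟨hinj, hc'.symm⟩).2 w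
    rw [polar_smul_right, polar_self_of_singular hv] at hvw
    simp at hvw

end Counting

/-! ### Balanced functions on elliptic quadrics in projective five-space -/

section Elliptic
open scoped Classical

variable {F E : Type*} [Field F] [AddCommGroup E] [Module F E] [Fintype F] [Fintype E]

/-- Nondegenerate quadratic spaces with `q ^ 6` vectors over a field of `q` elements, `q` odd,
in which no three independent singular vectors are pairwise orthogonal. -/
structure IsEllipticSix (Q : QuadraticForm F E) : Prop where
  two_ne_zero : (2 : F) ≠ 0
  sep : Q.polarBilin.SeparatingLeft
  card : Fintype.card E = Fintype.card F ^ 6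
  witt : ∀ u v w : E, LinearIndependent F ![u, v, w] → Q u = 0 → Q v = 0 → Q w = 0 →
    polar Q u v = 0 → polar Q u w = 0 → polar Q v w = 0 → False

/-- Functions on the singular points of a quadric, viewed as functions on the vectors, whose values
sum to zero on each line of the quadric. -/
structure IsBalanced (Q : QuadraticForm F E) (χ : E → ℤ) : Prop where
  map_zero : χ 0 = 0
  map_nonsingular : ∀ v, Q v ≠ 0 → χ v = 0
  map_smul : ∀ (a : F) v, a ≠ 0 → χ (a • v) = χ v
  line : ∀ u v, LinearIndependent F ![u, v] → Q u = 0 → Q v = 0 → polar Q u v = 0 →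
    ∑ a : F, ∑ b : F, χ (a • u + b • v) = 0

variable {Q : QuadraticForm F E} {x y : E}

omit [Fintype F] [Fintype E] in
/-- The orthogonal complement of a hyperbolic pair in an elliptic quadric contains no lines. -/
theorem exists_smul_of_orthogonal
    (hW : ∀ u v w : E, LinearIndependent F ![u, v, w] → Q u = 0 → Q v = 0 → Q w = 0 →
      polar Q u v = 0 → polar Q u w = 0 → polar Q v w = 0 → False)
    (hx : Q x = 0) (hxy : polar Q x y = 1) {e w : perpPair Q x y} (he0 : e ≠ 0)
    (he : Q e = 0) (hw : Q w = 0) (hew : polar Q (e : E) w = 0) : ∃ a : F, w = a • e := by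
  obtain ⟨e, he'⟩ := e
  obtain ⟨w, hw'⟩ := w
  rw [mem_perpPair] at he' hw'
  simp only [ne_eq, Submodule.mk_eq_zero] at he0 he hw hew
  by_contra! hne
  refine hW x e w ?_ hx he hw he'.1 hw'.1 hew
  rw [Fintype.linearIndependent_iff]
  intro g hg
  simp only [Fin.sum_univ_three, Matrix.cons_val_zero, Matrix.cons_val_one, Matrix.cons_val] at hg
  have h0 : g 0 = 0 := by
    have := congrArg (polar Q y) hg
    simpa [polar_add_right, polar_smul_right, he'.2, hw'.2, polar_comm _ y x, hxy] using this
  rw [h0, zero_smul, zero_add] at hg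
  have h2 : g 2 = 0 := by
    by_contra h2
    refine hne (-(g 1 / g 2)) (Subtype.ext ?_)
    change w = -(g 1 / g 2) • e
    rw [← sub_eq_zero, ← smul_right_injective E h2 |>.eq_iff]
    simp only [smul_sub, smul_smul, smul_zero]
    rw [show g 2 * -(g 1 / g 2) = -g 1 by field_simp, neg_smul, sub_neg_eq_add, add_comm]
    exact hg
  rw [h2, zero_smul, add_zero] at hg
  have h1 : g 1 = 0 := (smul_eq_zero.1 hg).resolve_right he0
  intro i
  fin_cases i <;> assumption

omit [Fintype F] in
theorem numSingular_restr (U : Submodule F E) :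
    numSingular (restr Q U) = ∑ v : U, if Q v = 0 then 1 else 0 := rfl

omit [Fintype F] [Fintype E] in
theorem linearIndependent_perpPair (hxy : polar Q x y = 1) {e : perpPair Q x y} (he : e ≠ 0) :
    LinearIndependent F ![x, (e : E)] := by
  rw [LinearIndependent.pair_iff]
  intro a b h
  have ha : a = 0 := by
    have := congrArg (polar Q y) h
    simpa [polar_add_right, polar_smul_right, (mem_perpPair.1 e.2).2, polar_comm _ y x, hxy]
      using this
  rw [ha, zero_smul, zero_add] at h
  exact ⟨ha, (smul_eq_zero.1 h).resolve_right (by simpa using he)⟩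

namespace IsEllipticSix

variable (hE : IsEllipticSix Q)
include hE

theorem card_perpPair (hx : Q x = 0) (hy : Q y = 0) (hxy : polar Q x y = 1) :
    Fintype.card (perpPair Q x y) = Fintype.card F ^ 4 := by
  have h := CPHemisystem.card_perpPair hx hy hxy
  rw [hE.card] at h
  exact Nat.eq_of_mul_eq_mul_left (by positivity) (h.symm.trans (by ring))

/-- The complement of a hyperbolic pair meets the quadric in `q ^ 2 + 1` points. -/
theorem numSingular_perpPair (hx : Q x = 0) (hy : Q y = 0) (hxy : polar Q x y = 1) :
    numSingular (restr Q (perpPair Q x y)) =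
      (Fintype.card F : ℤ) ^ 3 - (Fintype.card F : ℤ) ^ 2 + Fintype.card F := by
  have hF : 1 < Fintype.card F := Fintype.one_lt_card
  have hc := hE.card_perpPair hx hy hxy
  obtain ⟨u, hu0, hu⟩ := exists_singular (restr Q (perpPair Q x y)) hE.two_ne_zero
    (by rw [hc]; exact Nat.pow_lt_pow_right hF (by norm_num))
  obtain ⟨v, hv, huv⟩ := exists_hyperbolic_partner (separatingLeft_perpPair hE.sep hx hy hxy) hu0 hu
  have hc' := CPHemisystem.card_perpPair hu hv huv
  have hc'' : Fintype.card (perpPair (restr Q (perpPair Q x y)) u v) = Fintype.card F ^ 2 := by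
    rw [hc] at hc'
    exact Nat.eq_of_mul_eq_mul_left (by positivity) (hc'.symm.trans (by ring))
  rw [numSingular_split hu hv huv, hc'', numSingular_of_anisotropic]
  · push_cast; ring
  · rintro ⟨m, hm⟩ hm0
    rw [mem_perpPair] at hm
    obtain ⟨a, rfl⟩ := exists_smul_of_orthogonal hE.witt hx hxy hu0 hu hm0 hm.1
    have ha : a = 0 := by simpa [polar_smul_right, polar_comm _ v u, huv] using hm.2
    simp [ha]

theorem exists_pair : ∃ x y : E, Q x = 0 ∧ Q y = 0 ∧ polar Q x y = 1 := by
  have hF : 1 < Fintype.card F := Fintype.one_lt_card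
  obtain ⟨x, hx0, hx⟩ := exists_singular Q hE.two_ne_zero
    (by rw [hE.card]; exact Nat.pow_lt_pow_right hF (by norm_num))
  obtain ⟨y, hy, hxy⟩ := exists_hyperbolic_partner hE.sep hx0 hx
  exact ⟨x, y, hx, hy, hxy⟩

/-- The quadric has `(q ^ 3 + 1) (q + 1)` points. -/
theorem numSingular_eq :
    numSingular Q =
      (Fintype.card F : ℤ) ^ 5 - (Fintype.card F : ℤ) ^ 3 + (Fintype.card F : ℤ) ^ 2 := by
  obtain ⟨x, y, hx, hy, hxy⟩ := hE.exists_pair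
  rw [numSingular_split hx hy hxy, hE.card_perpPair hx hy hxy, hE.numSingular_perpPair hx hy hxy]
  push_cast; ring

/-- The number of singular vectors in the complement of a hyperbolic pair that are orthogonal to a
given vector of this complement. For a nonsingular vector this says that every three pairwise
noncollinear points of the quadric are collinear with exactly `q + 1` common points. -/
theorem sum_orthogonal_perpPair (hx : Q x = 0) (hy : Q y = 0) (hxy : polar Q x y = 1)
    (e : perpPair Q x y) :
    (∑ w : perpPair Q x y, if Q w = 0 ∧ polar Q (e : E) w = 0 then 1 else 0 : ℤ) =
      if Q e = 0 then
        if e = 0 then (Fintype.card F : ℤ) ^ 3 - (Fintype.card F : ℤ) ^ 2 + Fintype.card F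
        else Fintype.card F
      else (Fintype.card F : ℤ) ^ 2 := by
  split_ifs with he he0
  · rw [← hE.numSingular_perpPair hx hy hxy]
    refine Finset.sum_congr rfl fun w _ => ?_
    by_cases hw : Q w = 0 <;> simp [he0, hw]
  · have h (w : perpPair Q x y) : (Q w = 0 ∧ polar Q (e : E) w = 0) ↔
        w ∈ Finset.univ.image fun a : F => a • e := by
      simp only [Finset.mem_image, Finset.mem_univ, true_and]
      constructor
      · rintro ⟨h1, h2⟩
        obtain ⟨a, ha⟩ := exists_smul_of_orthogonal hE.witt hx hxy he0 he h1 h2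
        exact ⟨a, ha.symm⟩
      · rintro ⟨a, rfl⟩
        simp [QuadraticMap.map_smul, polar_smul_right, he, polar_self]
    simp_rw [h]
    rw [Finset.sum_ite_mem, Finset.univ_inter, Finset.sum_const,
      Finset.card_image_of_injective _ (smul_left_injective F he0)]
    simp
  · have he' : polar (restr Q (perpPair Q x y)) e e ≠ 0 := by
      rw [polar_restr, polar_self]
      simpa [hE.two_ne_zero] using he
    have hc := card_perp he'
    rw [hE.card_perpPair hx hy hxy] at hc
    have hF : 0 < Fintype.card F := Fintype.card_pos
    rw [← numSingular_ternary hE.two_ne_zero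
      (separatingLeft_perp (separatingLeft_perpPair hE.sep hx hy hxy) he')
      (Nat.eq_of_mul_eq_mul_left hF (hc.symm.trans (by ring))),
      numSingular_restr,
      ← Finset.sum_subtype (p := fun w => w ∈ perp (restr Q (perpPair Q x y)) e)
        (Finset.univ.filter fun w : perpPair Q x y => polar Q (e : E) w = 0)
        (fun w => by simp [mem_perp, polar_restr])
        (fun w : perpPair Q x y => if restr Q (perpPair Q x y) w = 0 then (1 : ℤ) else 0),
      Finset.sum_filter]
    refine Finset.sum_congr rfl fun w _ => ?_
    by_cases hw : Q w = 0 <;> simp [hw]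

end IsEllipticSix

/-- The sum of the values of `χ` at the vectors orthogonal to `x`. -/
def perpSum (Q : QuadraticForm F E) (χ : E → ℤ) (x : E) : ℤ :=
  ∑ z, if polar Q x z = 0 then χ z else 0

namespace IsBalanced

variable {χ : E → ℤ} (hχ : IsBalanced Q χ)
include hχ

omit [Fintype E] in
theorem sum_smul (x : E) : ∑ a : F, χ (a • x) = ((Fintype.card F : ℤ) - 1) * χ x := by
  rw [← Finset.add_sum_erase _ _ (Finset.mem_univ (0 : F)), zero_smul, hχ.map_zero, zero_add,
    Finset.sum_congr rfl fun a ha => hχ.map_smul a x (Finset.ne_of_mem_erase ha),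
    Finset.sum_const, Finset.card_erase_of_mem (Finset.mem_univ _), Finset.card_univ, nsmul_eq_mul,
    Nat.cast_sub Fintype.card_pos, Nat.cast_one]

omit [Fintype E] in
/-- The points other than `x` of a line of the quadric through `x` have total weight `- χ x`. -/
theorem sum_smul_add {e : E} (hxe : LinearIndependent F ![x, e]) (hx : Q x = 0) (he : Q e = 0)
    (h : polar Q x e = 0) : ∑ a : F, χ (a • x + e) = - χ x := by
  have hl := hχ.line x e hxe hx he h
  have h1 (b : F) (hb : b ≠ 0) : ∑ a : F, χ (a • x + b • e) = ∑ a : F, χ (a • x + e) := by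
    refine Fintype.sum_equiv (Equiv.mulLeft₀ b⁻¹ (inv_ne_zero hb)) _ _ fun a => ?_
    rw [Equiv.mulLeft₀_apply, ← hχ.map_smul b (_ + e) hb, smul_add, smul_smul,
      mul_inv_cancel_left₀ hb]
  rw [Finset.sum_comm, ← Finset.add_sum_erase _ _ (Finset.mem_univ (0 : F)),
    Finset.sum_congr rfl fun b hb => h1 b (Finset.ne_of_mem_erase hb), Finset.sum_const,
    Finset.card_erase_of_mem (Finset.mem_univ _), Finset.card_univ, nsmul_eq_mul,
    Nat.cast_sub Fintype.card_pos, Nat.cast_one] at hl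
  simp only [zero_smul, add_zero, hχ.sum_smul] at hl
  rw [← mul_add] at hl
  have hF : ((Fintype.card F : ℤ) - 1) ≠ 0 := by
    have : 1 < Fintype.card F := Fintype.one_lt_card
    omega
  have := (mul_eq_zero.1 hl).resolve_left hF
  linarith

variable (hE : IsEllipticSix Q)
include hE

/-- The values of `χ` form an eigenvector of the orthogonality relation. The sum over the points
orthogonal to `x` is collected along the `q ^ 2 + 1` lines of the quadric through `x`. -/
theorem perpSum_of_ne_zero (hx0 : x ≠ 0) (hx : Q x = 0) :
    perpSum Q χ x = - ((Fintype.card F : ℤ) ^ 2 * ((Fintype.card F : ℤ) - 1)) * χ x := by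
  obtain ⟨y, hy, hxy⟩ := exists_hyperbolic_partner hE.sep hx0 hx
  have h1 (e : perpPair Q x y) : (∑ a : F, ∑ b : F,
      if polar Q x (a • x + b • y + e) = 0 then χ (a • x + b • y + e) else 0) =
      χ x * (- (if Q e = 0 then 1 else 0) + Fintype.card F * if e = 0 then 1 else 0) := by
    have h (a b : F) : polar Q x (a • x + b • y + e) = b := by
      simp [polar_add_right, polar_smul_right, polar_self_of_singular hx, hxy,
        (mem_perpPair.1 e.2).1]
    simp_rw [h, Finset.sum_ite_eq', Finset.mem_univ, if_true, zero_smul, add_zero]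
    by_cases he : Q e = 0
    · by_cases he0 : e = 0
      · simp only [he0, ZeroMemClass.coe_zero, add_zero, hχ.sum_smul, QuadraticMap.map_zero,
          if_true]
        ring
      · rw [hχ.sum_smul_add (linearIndependent_perpPair hxy he0) hx he (mem_perpPair.1 e.2).1]
        simp [he, he0]
    · rw [Finset.sum_eq_zero fun a _ => hχ.map_nonsingular _ ?_]
      · have he0 : e ≠ 0 := by rintro rfl; simp at he
        simp [he, he0]
      · have := map_hyperbolicSplit Q hx hy hxy a 0 e
        simp only [zero_smul, add_zero, mul_zero, zero_add] at this
        rwa [this]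
  have h2 := hE.numSingular_perpPair hx hy hxy
  rw [numSingular_restr] at h2
  rw [perpSum, sum_hyperbolicSplit hx hy hxy, Finset.sum_congr rfl fun e _ => h1 e,
    ← Finset.mul_sum, Finset.sum_add_distrib, Finset.sum_neg_distrib, h2, ← Finset.mul_sum]
  simp
  ring

omit hχ in
/-- The number of singular vectors orthogonal to a given one. -/
theorem _root_.CPHemisystem.IsEllipticSix.sum_orthogonal (hx0 : x ≠ 0) (hx : Q x = 0) :
    (∑ z, if Q z = 0 ∧ polar Q x z = 0 then 1 else 0 : ℤ) =
      (Fintype.card F : ℤ) ^ 4 - (Fintype.card F : ℤ) ^ 3 + (Fintype.card F : ℤ) ^ 2 := by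
  obtain ⟨y, hy, hxy⟩ := exists_hyperbolic_partner hE.sep hx0 hx
  have h1 (e : perpPair Q x y) : (∑ a : F, ∑ b : F,
      if Q (a • x + b • y + e) = 0 ∧ polar Q x (a • x + b • y + e) = 0 then (1 : ℤ) else 0) =
      Fintype.card F * if Q e = 0 then 1 else 0 := by
    have h (a b : F) : polar Q x (a • x + b • y + e) = b := by
      simp [polar_add_right, polar_smul_right, polar_self_of_singular hx, hxy,
        (mem_perpPair.1 e.2).1]
    have h' (a b : F) : (if Q (a • x + b • y + e) = 0 ∧ polar Q x (a • x + b • y + e) = 0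
        then (1 : ℤ) else 0) = if b = 0 then (if Q e = 0 then 1 else 0) else 0 := by
      rw [h, map_hyperbolicSplit Q hx hy hxy]
      by_cases hb : b = 0 <;> simp [hb]
    simp_rw [h', Finset.sum_ite_eq', Finset.mem_univ, if_true, Finset.sum_const, Finset.card_univ]
    rw [nsmul_eq_mul]
  have h2 := hE.numSingular_perpPair hx hy hxy
  rw [numSingular_restr] at h2
  rw [sum_hyperbolicSplit hx hy hxy, Finset.sum_congr rfl fun e _ => h1 e, ← Finset.mul_sum, h2]
  ring

/-- A weight that is balanced on all lines is balanced on the whole quadric: the singular vectors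
orthogonal to a point are counted in two ways. -/
theorem sum_eq_zero : ∑ z, χ z = 0 := by
  set q : ℤ := (Fintype.card F : ℤ) with hq
  have hq1 : 1 < q := by
    have : 1 < Fintype.card F := Fintype.one_lt_card
    omega
  have h1 : ∑ x, (if Q x = 0 then perpSum Q χ x else 0) =
      - (q ^ 2 * (q - 1)) * ∑ z, χ z + ∑ z, χ z := by
    have h (x : E) : (if Q x = 0 then perpSum Q χ x else 0) =
        - (q ^ 2 * (q - 1)) * χ x + if x = 0 then ∑ z, χ z else 0 := by
      by_cases hx0 : x = 0
      · simp [hx0, hχ.map_zero, perpSum]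
      by_cases hx : Q x = 0
      · rw [if_pos hx, if_neg hx0, hχ.perpSum_of_ne_zero hE hx0 hx, add_zero]
      · simp [hx, hx0, hχ.map_nonsingular x hx]
    simp_rw [h, Finset.sum_add_distrib, Finset.mul_sum, Finset.sum_ite_eq', Finset.mem_univ,
      if_true]
  have h2 : ∑ x, (if Q x = 0 then perpSum Q χ x else 0) =
      (q ^ 4 - q ^ 3 + q ^ 2) * ∑ z, χ z := by
    have h (z : E) : (∑ x, if Q x = 0 then (if polar Q x z = 0 then χ z else 0) else 0) =
        (q ^ 4 - q ^ 3 + q ^ 2) * χ z := by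
      by_cases hz0 : z = 0
      · simp [hz0, hχ.map_zero]
      by_cases hz : Q z = 0
      · rw [← hE.sum_orthogonal hz0 hz, Finset.sum_mul]
        refine Finset.sum_congr rfl fun x _ => ?_
        rw [polar_comm _ x z]
        by_cases hx : Q x = 0 <;> simp [hx]
      · simp [hχ.map_nonsingular z hz]
    rw [Finset.mul_sum, ← Finset.sum_congr rfl fun z _ => h z, Finset.sum_comm]
    refine Finset.sum_congr rfl fun x _ => ?_
    by_cases hx : Q x = 0 <;> simp [hx, perpSum]
  have h3 : (q ^ 4 - 1) * ∑ z, χ z = 0 := by linear_combination h1 - h2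
  refine (mul_eq_zero.1 h3).resolve_left ?_
  have : 1 < q ^ 4 := one_lt_pow₀ hq1 (by norm_num)
  omega

theorem perpSum_eq (hx : Q x = 0) :
    perpSum Q χ x = - ((Fintype.card F : ℤ) ^ 2 * ((Fintype.card F : ℤ) - 1)) * χ x := by
  by_cases hx0 : x = 0
  · simp [hx0, hχ.map_zero, perpSum, hχ.sum_eq_zero hE]
  · exact hχ.perpSum_of_ne_zero hE hx0 hx

/-- The sum of `χ` over the common orthogonal complement `W` of two noncollinear points. The sum of
`χ z` over the orthogonal pairs `w ∈ W`, `z` is computed from the eigenvector property for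
fixed `w`, and from the number of `w ∈ W` orthogonal to `z` for fixed `z`. -/
theorem sum_perpPair (hx : Q x = 0) (hy : Q y = 0) (hxy : polar Q x y = 1) :
    ∑ w : perpPair Q x y, χ w =
      - ((Fintype.card F : ℤ) * ((Fintype.card F : ℤ) - 1)) * (χ x + χ y) := by
  set q : ℤ := (Fintype.card F : ℤ) with hq
  have hq1 : 1 < q := by
    have : 1 < Fintype.card F := Fintype.one_lt_card
    omega
  set s := ∑ w : perpPair Q x y, χ w with hs
  have hyx : polar Q y x = 1 := by rw [polar_comm, hxy]
  have hpx (a b : F) (e : perpPair Q x y) : polar Q x (a • x + b • y + e) = b := by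
    simp [polar_add_right, polar_smul_right, polar_self_of_singular hx, hxy,
      (mem_perpPair.1 e.2).1]
  have hpy (a b : F) (e : perpPair Q x y) : polar Q y (a • x + b • y + e) = a := by
    simp [polar_add_right, polar_smul_right, polar_self_of_singular hy, hyx,
      (mem_perpPair.1 e.2).2]
  have hpw (a b : F) (e w : perpPair Q x y) :
      polar Q (w : E) (a • x + b • y + e) = polar Q (e : E) w := by
    simp [polar_comm _ (w : E), mem_perpPair.1 w.2]
  -- Summation over `z` first.
  have hT1 : ∑ w : perpPair Q x y, (if Q w = 0 then perpSum Q χ w else 0) =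
      - (q ^ 2 * (q - 1)) * s := by
    rw [hs, Finset.mul_sum]
    refine Finset.sum_congr rfl fun w _ => ?_
    by_cases hw : Q w = 0
    · rw [if_pos hw, hχ.perpSum_eq hE hw]
    · rw [if_neg hw, hχ.map_nonsingular _ hw, mul_zero]
  -- The inclusion-exclusion formula for the number of `w` orthogonal to `z = a x + b y + e`; the last
  -- two terms are the corrections at the multiples of `x` and of `y`.
  have hn (a b : F) (e : perpPair Q x y) :
      (∑ w : perpPair Q x y, if Q w = 0 ∧ polar Q (e : E) w = 0 then 1 else 0 : ℤ) *
        χ (a • x + b • y + e) =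
      q ^ 2 * χ (a • x + b • y + e)
        - (q ^ 2 - q) * (if b = 0 then χ (a • x + b • y + e) else 0)
        - (q ^ 2 - q) * (if a = 0 then χ (a • x + b • y + e) else 0)
        + (q ^ 2 - q) * (if a = 0 then (if b = 0 then χ (a • x + b • y + e) else 0) else 0)
        + (q ^ 3 - q ^ 2) * (if e = 0 then (if b = 0 then χ (a • x + b • y + e) else 0) else 0)
        + (q ^ 3 - q ^ 2) *
          (if e = 0 then (if a = 0 then χ (a • x + b • y + e) else 0) else 0) := by
    rw [hE.sum_orthogonal_perpPair hx hy hxy]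
    by_cases hz : Q (a • x + b • y + e) = 0
    · rw [map_hyperbolicSplit Q hx hy hxy] at hz
      by_cases he : Q e = 0
      · rw [he, add_zero] at hz
        rcases mul_eq_zero.1 hz with rfl | rfl
        · by_cases he0 : e = 0 <;> by_cases hb : b = 0 <;>
            simp [he, he0, hb, hχ.map_zero] <;> ring
        · by_cases he0 : e = 0 <;> by_cases ha : a = 0 <;>
            simp [he, he0, ha, hχ.map_zero] <;> ring
      · have ha : a ≠ 0 := by rintro rfl; simp [he] at hz
        have hb : b ≠ 0 := by rintro rfl; simp [he] at hz
        have he0 : e ≠ 0 := by rintro rfl; simp at he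
        simp [he, ha, hb, he0, hq]
    · simp [hχ.map_nonsingular _ hz]
  -- Summation over `w` first.
  have hT2 : ∑ w : perpPair Q x y, (if Q w = 0 then perpSum Q χ w else 0) =
      ∑ e : perpPair Q x y, ∑ a : F, ∑ b : F,
      (∑ w : perpPair Q x y, if Q w = 0 ∧ polar Q (e : E) w = 0 then 1 else 0 : ℤ) *
        χ (a • x + b • y + e) := by
    have h (w : perpPair Q x y) : (if Q w = 0 then perpSum Q χ w else 0) =
        ∑ e : perpPair Q x y, ∑ a : F, ∑ b : F,
        (if Q w = 0 ∧ polar Q (e : E) w = 0 then 1 else 0 : ℤ) * χ (a • x + b • y + e) := by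
      by_cases hw : Q w = 0
      · rw [if_pos hw, perpSum, sum_hyperbolicSplit hx hy hxy]
        simp only [hpw, hw, true_and, ite_mul, one_mul, zero_mul]
      · simp [hw]
    simp_rw [h, Finset.sum_mul]
    rw [Finset.sum_comm]
    refine Finset.sum_congr rfl fun e _ => ?_
    rw [Finset.sum_comm]
    refine Finset.sum_congr rfl fun a _ => ?_
    rw [Finset.sum_comm]
  have e1 : ∑ e : perpPair Q x y, ∑ a : F, ∑ b : F, χ (a • x + b • y + e) = 0 := by
    rw [← sum_hyperbolicSplit hx hy hxy, hχ.sum_eq_zero hE]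
  have e2 : ∑ e : perpPair Q x y, ∑ a : F, ∑ b : F,
      (if b = 0 then χ (a • x + b • y + e) else 0) = - (q ^ 2 * (q - 1)) * χ x := by
    rw [← hχ.perpSum_eq hE hx, perpSum, sum_hyperbolicSplit hx hy hxy]
    simp only [hpx]
  have e3 : ∑ e : perpPair Q x y, ∑ a : F, ∑ b : F,
      (if a = 0 then χ (a • x + b • y + e) else 0) = - (q ^ 2 * (q - 1)) * χ y := by
    rw [← hχ.perpSum_eq hE hy, perpSum, sum_hyperbolicSplit hx hy hxy]
    simp only [hpy]
  have e4 : ∑ e : perpPair Q x y, ∑ a : F, ∑ b : F,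
      (if a = 0 then (if b = 0 then χ (a • x + b • y + e) else 0) else 0) = s := by
    refine Finset.sum_congr rfl fun e _ => ?_
    rw [Finset.sum_comm]
    simp
  have e5 : ∑ e : perpPair Q x y, ∑ a : F, ∑ b : F,
      (if e = 0 then (if b = 0 then χ (a • x + b • y + e) else 0) else 0) = (q - 1) * χ x := by
    rw [← hχ.sum_smul, Finset.sum_eq_single 0 (fun e _ he => by simp [he]) (by simp)]
    simp
  have e6 : ∑ e : perpPair Q x y, ∑ a : F, ∑ b : F,
      (if e = 0 then (if a = 0 then χ (a • x + b • y + e) else 0) else 0) = (q - 1) * χ y := by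
    rw [← hχ.sum_smul, Finset.sum_eq_single 0 (fun e _ he => by simp [he]) (by simp),
      Finset.sum_comm]
    simp
  rw [hT1] at hT2
  simp_rw [hn, Finset.sum_add_distrib, Finset.sum_sub_distrib, ← Finset.mul_sum, e1, e2, e3, e4,
    e5, e6] at hT2
  have h4 : (q * (q * q - 1)) * (s + q * (q - 1) * (χ x + χ y)) = 0 := by
    linear_combination (-1 : ℤ) * hT2
  have h5 : q * (q * q - 1) ≠ 0 := by
    have : 1 < q * q := by nlinarith
    exact mul_ne_zero (by omega) (by omega)
  linarith [(mul_eq_zero.1 h4).resolve_left h5]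

end IsBalanced

end Elliptic

/-! ### Projective points and their vectors -/

section Points
open scoped Classical

variable {F E : Type*} [Field F] [AddCommGroup E] [Module F E]

theorem isTotallySingular_span_pair {Q : QuadraticForm F E} {u v : E} :
    IsTotallySingular Q (Submodule.span F {u, v}) ↔ Q u = 0 ∧ Q v = 0 ∧ polar Q u v = 0 := by
  constructor
  · intro h
    have hu := h u (Submodule.mem_span_of_mem (by simp))
    have hv := h v (Submodule.mem_span_of_mem (by simp))
    refine ⟨hu, hv, ?_⟩
    rw [polar, h _ (add_mem (Submodule.mem_span_of_mem (by simp))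
      (Submodule.mem_span_of_mem (by simp))), hu, hv]
    simp
  · rintro ⟨hu, hv, huv⟩ w hw
    obtain ⟨a, b, rfl⟩ := Submodule.mem_span_pair.1 hw
    rw [map_lin, hu, hv, huv]
    simp

theorem mk_mem_quadric {Q : QuadraticForm F E} {v : E} (hv : v ≠ 0) :
    Projectivization.mk F v hv ∈ quadric Q ↔ Q v = 0 := by
  rw [quadric, Set.mem_ofPred_eq, Projectivization.submodule_mk]
  constructor
  · intro h; exact h v (Submodule.mem_span_singleton_self v)
  · intro h w hw
    obtain ⟨a, rfl⟩ := Submodule.mem_span_singleton.1 hw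
    rw [QuadraticMap.map_smul, h, smul_zero]

theorem mk_mem_pointsOn {L : Submodule F E} {v : E} (hv : v ≠ 0) :
    Projectivization.mk F v hv ∈ pointsOn L ↔ v ∈ L := by
  rw [pointsOn, Set.mem_ofPred_eq, Projectivization.submodule_mk,
    Submodule.span_singleton_le_iff_mem]

theorem mk_ne_mk_iff {u v : E} (hu : u ≠ 0) (hv : v ≠ 0) :
    Projectivization.mk F u hu ≠ Projectivization.mk F v hv ↔ LinearIndependent F ![u, v] := by
  rw [ne_eq, Projectivization.mk_eq_mk_iff', LinearIndependent.pair_iff' hu]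
  constructor
  · rintro h a rfl
    have ha : a ≠ 0 := by rintro rfl; simp at hv
    exact h ⟨a⁻¹, by rw [smul_smul, inv_mul_cancel₀ ha, one_smul]⟩
  · rintro h ⟨a, rfl⟩
    have ha : a ≠ 0 := by rintro rfl; simp at hu
    exact h a⁻¹ (by rw [smul_smul, inv_mul_cancel₀ ha, one_smul])

theorem mk_smul {v : E} (hv : v ≠ 0) {a : F} (ha : a ≠ 0) :
    Projectivization.mk F (a • v) (smul_ne_zero ha hv) = Projectivization.mk F v hv :=
  (Projectivization.mk_eq_mk_iff' _ _ _ _ _).2 ⟨a, rfl⟩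

theorem collinearityGraph_adj_mk {Q : QuadraticForm F E} {u v : E} (hu : u ≠ 0) (hv : v ≠ 0) :
    (collinearityGraph Q).Adj (Projectivization.mk F u hu) (Projectivization.mk F v hv) ↔
      Projectivization.mk F u hu ≠ Projectivization.mk F v hv ∧
        Q u = 0 ∧ Q v = 0 ∧ polar Q u v = 0 := by
  rw [← isTotallySingular_span_pair, Submodule.span_insert, ← Projectivization.submodule_mk u hu,
    ← Projectivization.submodule_mk v hv]
  rfl

/-- A line is spanned by two independent vectors. -/
theorem IsLine.exists_span {L : Submodule F E} (hL : IsLine L) :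
    ∃ u v, LinearIndependent F ![u, v] ∧ L = Submodule.span F {u, v} := by
  have : FiniteDimensional F L := Module.finite_of_finrank_eq_succ hL
  let b := Module.finBasisOfFinrankEq F L hL
  refine ⟨b 0, b 1, ?_, ?_⟩
  · have := b.linearIndependent.map' L.subtype L.ker_subtype
    have h : L.subtype ∘ b = ![(b 0 : E), b 1] := by ext i; fin_cases i <;> rfl
    rwa [h] at this
  · have h := congrArg (Submodule.map L.subtype) b.span_eq
    rw [Submodule.map_span, Submodule.map_top, Submodule.range_subtype] at h
    refine h.symm.trans (congrArg _ ?_)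
    ext w
    simp [Fin.exists_fin_two, eq_comm]

theorem isLine_span {u v : E} (h : LinearIndependent F ![u, v]) :
    IsLine (Submodule.span F {u, v}) := by
  have := finrank_span_eq_card h
  rwa [Matrix.range_cons, Matrix.range_cons, Matrix.range_empty, Set.union_empty,
    Set.singleton_union] at this

theorem IsLine.eq_span {L : Submodule F E} (hL : IsLine L) {u v : E} (hu : u ∈ L) (hv : v ∈ L)
    (h : LinearIndependent F ![u, v]) : L = Submodule.span F {u, v} := by
  have : FiniteDimensional F L := Module.finite_of_finrank_eq_succ hL
  refine (Submodule.eq_of_le_of_finrank_eq ?_ ((isLine_span h).trans hL.symm)).symm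
  rw [Submodule.span_le]
  rintro w (rfl | rfl) <;> assumption

variable [Fintype F] [Fintype E]

omit [Fintype F] in
theorem finite_points : Finite (ℙ F E) :=
  Finite.of_surjective (Projectivization.mk' F) Quotient.mk''_surjective

/-- The indicator function, on vectors, of a set of projective points. -/
def indicator (S : Set (ℙ F E)) (v : E) : ℤ :=
  if ∃ h : v ≠ 0, Projectivization.mk F v h ∈ S then 1 else 0

omit [Fintype E] [Fintype F] in
theorem indicator_of_ne_zero (S : Set (ℙ F E)) {v : E} (hv : v ≠ 0) :
    indicator S v = if Projectivization.mk F v hv ∈ S then 1 else 0 := by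
  simp [indicator, hv]

/-- Each point is represented by `q - 1` vectors. -/
theorem sum_indicator (S : Set (ℙ F E)) :
    ∑ v, indicator S v = ((Fintype.card F : ℤ) - 1) * S.ncard := by
  have e : (S × Fˣ) ≃ {v : E // ∃ h : v ≠ 0, Projectivization.mk F v h ∈ S} :=
    Equiv.ofBijective (fun p => ⟨(p.2 : F) • p.1.1.rep,
      smul_ne_zero p.2.ne_zero p.1.1.rep_nonzero, by
        rw [mk_smul p.1.1.rep_nonzero p.2.ne_zero, Projectivization.mk_rep]
        exact p.1.2⟩) (by
      constructor
      · rintro ⟨⟨p, hp⟩, a⟩ ⟨⟨r, hr⟩, b⟩ h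
        have h' : (a : F) • p.rep = (b : F) • r.rep := congrArg Subtype.val h
        have hpr : p = r := by
          rw [← p.mk_rep, ← r.mk_rep, ← mk_smul p.rep_nonzero a.ne_zero,
            ← mk_smul r.rep_nonzero b.ne_zero]
          congr 1
        subst hpr
        have := smul_left_injective F p.rep_nonzero h'
        rw [Units.val_inj.1 this]
      · rintro ⟨v, hv, hvS⟩
        obtain ⟨a, ha⟩ := Projectivization.exists_smul_eq_mk_rep F v hv
        refine ⟨⟨⟨_, hvS⟩, a⁻¹⟩, Subtype.ext ?_⟩
        change (a⁻¹ : Fˣ) • (Projectivization.mk F v hv).rep = v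
        rw [← ha, inv_smul_smul])
  have h := Nat.card_congr e
  rw [Nat.card_prod, Nat.card_coe_set_eq, Nat.card_eq_fintype_card, Fintype.card_units,
    Nat.card_eq_fintype_card, Fintype.card_subtype] at h
  simp only [indicator]
  rw [Finset.sum_boole, ← h]
  push_cast [Nat.cast_sub (Fintype.card_pos (α := F))]
  ring

theorem sum_span_pair {u v : E} (h : LinearIndependent F ![u, v]) (f : E → ℤ) :
    ∑ a : F, ∑ b : F, f (a • u + b • v) =
      ∑ w, if w ∈ Submodule.span F {u, v} then f w else 0 := by
  have hinj : Function.Injective fun p : F × F => p.1 • u + p.2 • v := by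
    rintro ⟨a, b⟩ ⟨c, d⟩ hp
    rw [LinearIndependent.pair_iff] at h
    have := h (a - c) (b - d) (by
      rw [sub_smul, sub_smul, sub_add_sub_comm, sub_eq_zero]
      exact hp)
    rw [sub_eq_zero, sub_eq_zero] at this
    exact Prod.ext this.1 this.2
  rw [← Fintype.sum_prod_type (f := fun p : F × F => f (p.1 • u + p.2 • v)),
    ← Finset.sum_image (f := f) (g := fun p : F × F => p.1 • u + p.2 • v) (hinj.injOn),
    ← Finset.univ_inter (Finset.image _ _), ← Finset.sum_ite_mem]
  refine Finset.sum_congr rfl fun w _ => ?_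
  simp [Submodule.mem_span_pair]

/-- The function on the vectors with value `1` at the points of `S`, `-1` at the other points of
the quadric `Q = 0`, and `0` elsewhere. -/
def signFun (Q : QuadraticForm F E) (S : Set (ℙ F E)) (v : E) : ℤ :=
  2 * indicator (S ∩ quadric Q) v - indicator (quadric Q) v

variable {Q : QuadraticForm F E} {S : Set (ℙ F E)}

omit [Fintype E] [Fintype F] in
theorem indicator_quadric (v : E) :
    indicator (quadric Q) v = (if Q v = 0 then 1 else 0) - if v = 0 then 1 else 0 := by
  by_cases hv : v = 0
  · simp [hv, indicator]
  · rw [indicator_of_ne_zero _ hv]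
    simp [mk_mem_quadric, hv]

/-- A line of the quadric has half of its points in `S` if and only if its signed sum vanishes. -/
theorem sum_signFun_span_pair {u v : E} (h : LinearIndependent F ![u, v]) (hu : Q u = 0)
    (hv : Q v = 0) (huv : polar Q u v = 0) :
    ∑ a : F, ∑ b : F, signFun Q S (a • u + b • v) = 0 ↔
      2 * (S ∩ pointsOn (Submodule.span F {u, v})).ncard = Nat.card F + 1 := by
  set L := Submodule.span F {u, v} with hL
  have hts : IsTotallySingular Q L := isTotallySingular_span_pair.2 ⟨hu, hv, huv⟩
  have hF : 1 < Fintype.card F := Fintype.one_lt_card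
  have h1 (w : E) : (if w ∈ L then signFun Q S w else 0) =
      2 * indicator (S ∩ pointsOn L) w - ((if w ∈ L then 1 else 0) - if w = 0 then 1 else 0) := by
    by_cases hw : w = 0
    · simp [hw, signFun, indicator]
    by_cases hwL : w ∈ L
    · simp [hw, hwL, signFun, indicator_of_ne_zero, hts w hwL,
        mk_mem_pointsOn, mk_mem_quadric]
    · simp [hw, hwL, indicator_of_ne_zero, mk_mem_pointsOn]
  have h2 : ∑ w, (if w ∈ L then (1 : ℤ) else 0) = (Fintype.card F : ℤ) ^ 2 := by
    rw [← sum_span_pair h fun _ => 1]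
    simp [_root_.sq]
  rw [sum_span_pair h, Finset.sum_congr rfl fun w _ => h1 w, Finset.sum_sub_distrib,
    Finset.sum_sub_distrib, ← Finset.mul_sum, sum_indicator, h2, Nat.card_eq_fintype_card]
  simp only [Finset.sum_ite_eq', Finset.mem_univ, if_true]
  have h3 : 2 * (((Fintype.card F : ℤ) - 1) * (S ∩ pointsOn L).ncard) -
      ((Fintype.card F : ℤ) ^ 2 - 1) = ((Fintype.card F : ℤ) - 1) *
        (2 * (S ∩ pointsOn L).ncard - (Fintype.card F + 1)) := by ring
  rw [h3, mul_eq_zero]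
  omega

/-- A set of points of the quadric with half of the points of every line gives a balanced
function. -/
theorem isBalanced_signFun
    (hline : ∀ L : Submodule F E, IsLine L → IsTotallySingular Q L →
      2 * (S ∩ pointsOn L).ncard = Nat.card F + 1) : IsBalanced Q (signFun Q S) where
  map_zero := by simp [signFun, indicator]
  map_nonsingular v hv := by
    have hv0 : v ≠ 0 := by rintro rfl; simp at hv
    simp [signFun, indicator_of_ne_zero, hv0, mk_mem_quadric, hv]
  map_smul a v ha := by
    by_cases hv : v = 0
    · simp [hv]
    · simp [signFun, indicator_of_ne_zero, smul_ne_zero ha hv, hv, mk_smul hv ha]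
  line u v h hu hv huv := (sum_signFun_span_pair h hu hv huv).2
    (hline _ (isLine_span h) (isTotallySingular_span_pair.2 ⟨hu, hv, huv⟩))

end Points

/-! ### The graph of a hemisystem -/

section StronglyRegular
open scoped Classical

variable {F E : Type*} [Field F] [AddCommGroup E] [Module F E] [Fintype F] [Fintype E]
variable {Q : QuadraticForm F E} {S : Set (ℙ F E)}

/-- Each point of `S` on `L` is represented by `q - 1` vectors of `L`, and twice the number of these
vectors is the number of all nonzero singular vectors of `L` plus their signed sum. -/
theorem two_mul_ncard_inter_pointsOn (hS : S ⊆ quadric Q) (L : Submodule F E) :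
    2 * (((Fintype.card F : ℤ) - 1) * (S ∩ pointsOn L).ncard) =
      (∑ z, if Q z = 0 ∧ z ∈ L then 1 else 0) - 1 + ∑ z, if z ∈ L then signFun Q S z else 0 := by
  have h (z : E) : 2 * indicator (S ∩ pointsOn L) z =
      (if Q z = 0 ∧ z ∈ L then 1 else 0) - (if z = 0 then 1 else 0) +
        if z ∈ L then signFun Q S z else 0 := by
    by_cases hz : z = 0
    · simp [hz, signFun, indicator]
    by_cases hzL : z ∈ L
    · simp [signFun, indicator_quadric, Set.inter_eq_left.2 hS]
      simp [hz, hzL, indicator_of_ne_zero, mk_mem_pointsOn]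
    · simp [hz, hzL, indicator_of_ne_zero, mk_mem_pointsOn]
  rw [← sum_indicator, Finset.mul_sum, Finset.sum_congr rfl fun z _ => h z,
    Finset.sum_add_distrib, Finset.sum_sub_distrib]
  simp

variable (hE : IsEllipticSix Q) (hS : S ⊆ quadric Q)
  (hline : ∀ L : Submodule F E, IsLine L → IsTotallySingular Q L →
      2 * (S ∩ pointsOn L).ncard = Nat.card F + 1)
include hE hS hline

theorem two_mul_ncard :
    2 * (S.ncard : ℤ) = ((Fintype.card F : ℤ) ^ 3 + 1) * (Fintype.card F + 1) := by
  have h := two_mul_ncard_inter_pointsOn hS ⊤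
  have hF : 1 < Fintype.card F := Fintype.one_lt_card
  have hF' : ((Fintype.card F : ℤ) - 1) ≠ 0 := by omega
  have htop : S ∩ pointsOn (⊤ : Submodule F E) = S :=
    Set.inter_eq_left.2 fun p _ => (le_top : p.submodule ≤ ⊤)
  have h' := hE.numSingular_eq
  rw [numSingular] at h'
  simp only [htop, Submodule.mem_top, and_true, if_true, h',
    (isBalanced_signFun hline).sum_eq_zero hE] at h
  refine mul_left_cancel₀ hF' ?_
  linear_combination h

/-- A set with half of the points of every line of an elliptic quadric contains half of the
points of the quadric. -/
theorem isHemisystem_of_line : IsHemisystem Q S where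
  subset := hS
  half := by
    have := finite_points (F := F) (E := E)
    have hF : 1 < Fintype.card F := Fintype.one_lt_card
    have hF' : ((Fintype.card F : ℤ) - 1) ≠ 0 := by omega
    have h1 := two_mul_ncard hE hS hline
    have h2 := sum_indicator (quadric Q)
    simp only [indicator_quadric, Finset.sum_sub_distrib] at h2
    have h' := hE.numSingular_eq
    rw [numSingular] at h'
    rw [h'] at h2
    have h3 := Set.ncard_sdiff_add_ncard_of_subset hS
    simp at h2
    have h4 : ((quadric Q).ncard : ℤ) = 2 * S.ncard := by
      refine mul_left_cancel₀ hF' ?_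
      linear_combination (-1 : ℤ) * h2 - ((Fintype.card F : ℤ) - 1) * h1
    omega
  line := hline

/-- The points of `S` collinear with or equal to a point `x` of `S`, counted through the eigenvector
property of the sign function. -/
theorem two_mul_ncard_perp {x : E} (hx0 : x ≠ 0) (hxS : Projectivization.mk F x hx0 ∈ S) :
    2 * ((S ∩ pointsOn (perp Q x)).ncard : ℤ) =
      ((Fintype.card F : ℤ) ^ 2 + 1) * (Fintype.card F - 1) + 2 := by
  have h := two_mul_ncard_inter_pointsOn hS (perp Q x)
  have hF : 1 < Fintype.card F := Fintype.one_lt_card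
  have hF' : ((Fintype.card F : ℤ) - 1) ≠ 0 := by omega
  have hx : Q x = 0 := (mk_mem_quadric hx0).1 (hS hxS)
  have h1 := hE.sum_orthogonal hx0 hx
  have h2 := (isBalanced_signFun hline).perpSum_eq hE hx
  have h3 : signFun Q S x = 1 := by
    simp [signFun, indicator_of_ne_zero, hx0, hxS, hS hxS]
  rw [perpSum, h3] at h2
  simp only [mem_perp, h1, h2] at h
  refine mul_left_cancel₀ hF' ?_
  linear_combination h

/-- The points of `S` collinear with two noncollinear points `x`, `y` of `S`. -/
theorem two_mul_ncard_perpPair {x y : E} (hx0 : x ≠ 0) (hxS : Projectivization.mk F x hx0 ∈ S)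
    (hy0 : y ≠ 0) (hyS : Projectivization.mk F y hy0 ∈ S) (hxy : polar Q x y ≠ 0) :
    2 * ((S ∩ pointsOn (perpPair Q x y)).ncard : ℤ) = ((Fintype.card F : ℤ) - 1) ^ 2 := by
  wlog h1 : polar Q x y = 1 generalizing y
  · have hc : (polar Q x y)⁻¹ ≠ 0 := inv_ne_zero hxy
    have hyc : polar Q x ((polar Q x y)⁻¹ • y) = 1 := by
      rw [polar_smul_right, smul_eq_mul, inv_mul_cancel₀ hxy]
    have hperp : perpPair Q x ((polar Q x y)⁻¹ • y) = perpPair Q x y := by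
      ext v
      simp [mem_perpPair, hxy]
    rw [← this (smul_ne_zero hc hy0) (by rwa [mk_smul hy0 hc]) (by rw [hyc]; exact one_ne_zero)
      hyc, hperp]
  have h := two_mul_ncard_inter_pointsOn hS (perpPair Q x y)
  have hF : 1 < Fintype.card F := Fintype.one_lt_card
  have hF' : ((Fintype.card F : ℤ) - 1) ≠ 0 := by omega
  have hx : Q x = 0 := (mk_mem_quadric hx0).1 (hS hxS)
  have hy : Q y = 0 := (mk_mem_quadric hy0).1 (hS hyS)
  have hN := hE.numSingular_perpPair hx hy h1
  have hs := (isBalanced_signFun hline).sum_perpPair hE hx hy h1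
  have hx1 : signFun Q S x = 1 := by
    simp [signFun, indicator_of_ne_zero, hx0, hxS, hS hxS]
  have hy1 : signFun Q S y = 1 := by
    simp [signFun, indicator_of_ne_zero, hy0, hyS, hS hyS]
  have hsub (f : E → ℤ) : ∑ w : perpPair Q x y, f w =
      ∑ z, if z ∈ perpPair Q x y then f z else 0 := by
    rw [← Finset.sum_filter]
    exact (Finset.sum_subtype _ (fun z => by simp) f).symm
  rw [numSingular_restr, hsub fun w => if Q w = 0 then 1 else 0] at hN
  rw [hsub, hx1, hy1] at hs
  have hN' : (∑ z, if Q z = 0 ∧ z ∈ perpPair Q x y then (1 : ℤ) else 0) =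
      (Fintype.card F : ℤ) ^ 3 - (Fintype.card F : ℤ) ^ 2 + Fintype.card F := by
    rw [← hN]
    refine Finset.sum_congr rfl fun z _ => ?_
    by_cases hz : Q z = 0 <;> simp [hz]
  rw [hs, hN'] at h
  refine mul_left_cancel₀ hF' ?_
  linear_combination h

omit hS hline in
/-- The points of `S` collinear with two points of a line of the quadric are on this line, as the
quadric contains no planes. -/
theorem mem_span_of_orthogonal {x y z : E} (hxy : LinearIndependent F ![x, y]) (hx : Q x = 0)
    (hy : Q y = 0) (hz : Q z = 0) (h : polar Q x y = 0) (h1 : polar Q x z = 0)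
    (h2 : polar Q y z = 0) : z ∈ Submodule.span F {x, y} := by
  by_contra hmem
  refine hE.witt z x y ?_ hz hx hy ?_ ?_ h
  · refine linearIndependent_finCons.2 ⟨hxy, ?_⟩
    rwa [Matrix.range_cons, Matrix.range_cons, Matrix.range_empty, Set.union_empty,
      Set.singleton_union]
  · rwa [polar_comm]
  · rwa [polar_comm]

/-- The graph on a hemisystem of an elliptic quadric is strongly regular. -/
theorem isStronglyRegular_of_line [Finite S] (hq : 3 ≤ Fintype.card F) :
    IsStronglyRegular ((collinearityGraph Q).induce S)
      ((Fintype.card F ^ 3 + 1) * (Fintype.card F + 1) / 2)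
      ((Fintype.card F ^ 2 + 1) * (Fintype.card F - 1) / 2)
      ((Fintype.card F - 3) / 2) ((Fintype.card F - 1) ^ 2 / 2) := by
  have := finite_points (F := F) (E := E)
  obtain ⟨r, hr⟩ := Nat.exists_eq_add_of_le hq
  have hcard := two_mul_ncard hE hS hline
  have hcoll {x : E} (hx0 : x ≠ 0) {z : E} (hz0 : z ≠ 0) (hx : Projectivization.mk F x hx0 ∈ S)
      (hz : Projectivization.mk F z hz0 ∈ S) :
      (collinearityGraph Q).Adj (Projectivization.mk F x hx0) (Projectivization.mk F z hz0) ↔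
        Projectivization.mk F x hx0 ≠ Projectivization.mk F z hz0 ∧ polar Q x z = 0 := by
    rw [collinearityGraph_adj_mk, (mk_mem_quadric hx0).1 (hS hx), (mk_mem_quadric hz0).1 (hS hz)]
    simp
  have hcommon (p r : S) (T : Set (ℙ F E))
      (hT : ∀ z ∈ S, z ∈ T ↔ (collinearityGraph Q).Adj p z ∧ (collinearityGraph Q).Adj r z) :
      (((collinearityGraph Q).induce S).commonNeighbors p r).ncard = (S ∩ T).ncard := by
    rw [← Set.ncard_image_of_injective _ Subtype.val_injective]
    congr 1
    ext z
    constructor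
    · rintro ⟨⟨z, hz⟩, h, rfl⟩
      exact ⟨hz, (hT z hz).2 h⟩
    · rintro ⟨hz, h⟩
      exact ⟨⟨z, hz⟩, (hT z hz).1 h, rfl⟩
  have hdeg (p : S) : (((collinearityGraph Q).induce S).neighborSet p).ncard =
      (Fintype.card F ^ 2 + 1) * (Fintype.card F - 1) / 2 := by
    rw [← Set.inter_self (SimpleGraph.neighborSet _ p)]
    obtain ⟨p, hp⟩ := p
    induction p using Projectivization.ind with | h x hx0
    have h := two_mul_ncard_perp hE hS hline hx0 hp
    have hx : Q x = 0 := (mk_mem_quadric hx0).1 (hS hp)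
    have hmem : Projectivization.mk F x hx0 ∈ S ∩ pointsOn (perp Q x) :=
      ⟨hp, (mk_mem_pointsOn hx0).2 (mem_perp.2 (polar_self_of_singular hx))⟩
    have hc := hcommon ⟨_, hp⟩ ⟨_, hp⟩ (pointsOn (perp Q x) \ {Projectivization.mk F x hx0}) (by
      intro z hz
      induction z using Projectivization.ind with | h z hz0
      rw [and_self, hcoll hx0 hz0 hp hz, Set.mem_sdiff, mk_mem_pointsOn, mem_perp,
        Set.mem_singleton_iff, and_comm, ne_comm])
    rw [← Set.inter_sdiff_assoc, Set.ncard_sdiff_singleton_of_mem hmem] at hc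
    change Set.ncard (SimpleGraph.commonNeighbors _ _ _) = _
    rw [hc]
    have h' : 2 * (S ∩ pointsOn (perp Q x)).ncard =
        (Fintype.card F ^ 2 + 1) * (Fintype.card F - 1) + 2 := by
      zify [show 1 ≤ Fintype.card F by omega]
      exact h
    omega
  refine ⟨?_, ?_, ?_⟩
  · have : 2 ≤ (Fintype.card F ^ 2 + 1) * (Fintype.card F - 1) :=
      le_trans (by omega) (Nat.mul_le_mul (Nat.le_add_left 1 _)
        (show 2 ≤ Fintype.card F - 1 by omega))
    omega
  · have h1 : (Fintype.card F ^ 2 + 1) * (Fintype.card F - 1) + 4 ≤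
        (Fintype.card F ^ 3 + 1) * (Fintype.card F + 1) := by
      rw [hr, show 3 + r - 1 = r + 2 by omega]
      ring_nf
      nlinarith [Nat.zero_le r]
    omega
  let := Fintype.ofFinite S
  let := Classical.decRel ((collinearityGraph Q).induce S).Adj
  constructor
  · rw [← Nat.card_eq_fintype_card, Nat.card_coe_set_eq]
    have : 2 * S.ncard = (Fintype.card F ^ 3 + 1) * (Fintype.card F + 1) := by
      exact_mod_cast hcard
    omega
  · intro p
    rw [← SimpleGraph.card_neighborSet_eq_degree, ← Nat.card_eq_fintype_card,
      Nat.card_coe_set_eq, hdeg]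
  · rintro ⟨p, hp⟩ ⟨r, hr⟩ hadj
    rw [← Nat.card_eq_fintype_card, Nat.card_coe_set_eq]
    induction p using Projectivization.ind with | h x hx0
    induction r using Projectivization.ind with | h y hy0
    have hx : Q x = 0 := (mk_mem_quadric hx0).1 (hS hp)
    have hy : Q y = 0 := (mk_mem_quadric hy0).1 (hS hr)
    obtain ⟨hne, hxy⟩ := (hcoll hx0 hy0 hp hr).1 hadj
    have hli := (mk_ne_mk_iff hx0 hy0).1 hne
    set L := Submodule.span F {x, y} with hL
    have hl := hline L (isLine_span hli) (isTotallySingular_span_pair.2 ⟨hx, hy, hxy⟩)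
    rw [hcommon _ _ (pointsOn L \ {Projectivization.mk F x hx0, Projectivization.mk F y hy0}) (by
      intro z hz
      induction z using Projectivization.ind with | h z hz0
      have hz' : Q z = 0 := (mk_mem_quadric hz0).1 (hS hz)
      have hmem : z ∈ L ↔ polar Q x z = 0 ∧ polar Q y z = 0 := by
        constructor
        · intro h
          obtain ⟨a, b, rfl⟩ := Submodule.mem_span_pair.1 h
          simp [polar_self_of_singular hx, polar_self_of_singular hy, hxy, polar_comm _ y x]
        · rintro ⟨h1, h2⟩
          exact mem_span_of_orthogonal hE hli hx hy hz' hxy h1 h2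
      rw [hcoll hx0 hz0 hp hz, hcoll hy0 hz0 hr hz, Set.mem_sdiff, mk_mem_pointsOn, hmem,
        Set.mem_insert_iff, Set.mem_singleton_iff, not_or, ne_comm,
        ne_comm (a := Projectivization.mk F y hy0)]
      tauto),
      ← Set.inter_sdiff_assoc, Set.ncard_sdiff, Set.ncard_pair hne]
    · rw [Nat.card_eq_fintype_card] at hl
      omega
    · rintro z (rfl | rfl)
      · exact ⟨hp, (mk_mem_pointsOn hx0).2 (Submodule.mem_span_of_mem (by simp))⟩
      · exact ⟨hr, (mk_mem_pointsOn hy0).2 (Submodule.mem_span_of_mem (by simp))⟩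
  · rintro ⟨p, hp⟩ ⟨r, hr⟩ hne hadj
    rw [← Nat.card_eq_fintype_card, Nat.card_coe_set_eq]
    induction p using Projectivization.ind with | h x hx0
    induction r using Projectivization.ind with | h y hy0
    have hx : Q x = 0 := (mk_mem_quadric hx0).1 (hS hp)
    have hy : Q y = 0 := (mk_mem_quadric hy0).1 (hS hr)
    have hne' : Projectivization.mk F x hx0 ≠ Projectivization.mk F y hy0 := by
      simpa using hne
    have hxy : polar Q x y ≠ 0 := fun h => hadj ((hcoll hx0 hy0 hp hr).2 ⟨hne', h⟩)
    rw [hcommon _ _ (pointsOn (perpPair Q x y)) (by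
      intro z hz
      induction z using Projectivization.ind with | h z hz0
      rw [hcoll hx0 hz0 hp hz, hcoll hy0 hz0 hr hz, mk_mem_pointsOn, mem_perpPair]
      constructor
      · rintro ⟨h1, h2⟩
        refine ⟨⟨?_, h1⟩, ?_, h2⟩ <;> rw [ne_eq, Projectivization.mk_eq_mk_iff']
        · rintro ⟨a, rfl⟩
          rcases eq_or_ne a 0 with rfl | ha
          · simp at hx0
          · rw [polar_smul_left, polar_comm, h2, smul_zero] at hxy
            exact hxy rfl
        · rintro ⟨a, rfl⟩
          rw [polar_smul_right, h1, smul_zero] at hxy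
          exact hxy rfl
      · rintro ⟨⟨-, h1⟩, -, h2⟩
        exact ⟨h1, h2⟩)]
    have h := two_mul_ncard_perpPair hE hS hline hx0 hp hy0 hr hxy
    have h' : 2 * (S ∩ pointsOn (perpPair Q x y)).ncard = (Fintype.card F - 1) ^ 2 := by
      zify [show 1 ≤ Fintype.card F by omega]
      exact h
    omega

end StronglyRegular

/-! ### The conic and its tangents -/

section Conic

variable {K : Type*} [Field K]

theorem formB_apply (v : Fin 3 → K) : formB K v = v 0 * v 1 + v 2 * v 2 := rfl

theorem polar_formB (v w : Fin 3 → K) :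
    polar (formB K) v w = v 0 * w 1 + w 0 * v 1 + 2 * (v 2 * w 2) := by
  simp only [polar, formB_apply, Pi.add_apply]
  ring

theorem formB_smul (a : K) (v : Fin 3 → K) : formB K (a • v) = a * a * formB K v := by
  rw [QuadraticMap.map_smul, smul_eq_mul]

/-- Points on a tangent of the conic take square values: the line `u^⊥` is the tangent at `u`. -/
theorem exists_sq_of_polar_eq_zero {u w : Fin 3 → K} (hu0 : u ≠ 0) (hu : formB K u = 0)
    (h : polar (formB K) u w = 0) :
    ∃ d, formB K w = d * d ∧ (d = 0 → ∃ k : K, w = k • u) := by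
  rw [formB_apply] at hu
  rw [polar_formB] at h
  by_cases hx : u 0 = 0
  · have hz : u 2 = 0 := by simpa [hx] using hu
    have hy : u 1 ≠ 0 := by
      intro hy
      exact hu0 (by ext i; fin_cases i <;> assumption)
    have hw : w 0 = 0 := by simpa [hx, hz, hy] using h
    refine ⟨w 2, by rw [formB_apply, hw]; ring, fun hd => ⟨w 1 / u 1, ?_⟩⟩
    ext i; fin_cases i
    · simp [hx, hw]
    · simp [hy]
    · simp [hz, hd]
  · have h1 : u 1 = - (u 2 * u 2) / u 0 := by
      rw [eq_div_iff hx]; linear_combination hu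
    have h2 : w 1 = - (w 0 * u 1 + 2 * (u 2 * w 2)) / u 0 := by
      rw [eq_div_iff hx]; linear_combination h
    refine ⟨(w 0 * u 2 - u 0 * w 2) / u 0, ?_, fun hd => ⟨w 0 / u 0, ?_⟩⟩
    · rw [formB_apply, h2, h1]
      field_simp
      ring
    · have hd' : w 0 * u 2 - u 0 * w 2 = 0 := by simpa [hx] using hd
      have h3 : w 2 = w 0 / u 0 * u 2 := by
        field_simp; linear_combination -hd'
      ext i; fin_cases i
      · simp [hx]
      · change w 1 = w 0 / u 0 * u 1
        rw [h2, h3, h1]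
        field_simp
        ring
      · exact h3

theorem isSquare_of_polar_eq_zero {u w : Fin 3 → K} (hu0 : u ≠ 0) (hu : formB K u = 0)
    (h : polar (formB K) u w = 0) : IsSquare (formB K w) :=
  let ⟨d, hd, _⟩ := exists_sq_of_polar_eq_zero hu0 hu h
  ⟨d, hd⟩

theorem exists_smul_of_polar_eq_zero {u w : Fin 3 → K} (hu0 : u ≠ 0) (hu : formB K u = 0)
    (hw : formB K w = 0) (h : polar (formB K) u w = 0) : ∃ k : K, w = k • u := by
  obtain ⟨d, hd, hk⟩ := exists_sq_of_polar_eq_zero hu0 hu h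
  exact hk (mul_self_eq_zero.1 (hd.symm.trans hw))

omit [Field K] in
theorem vec_ext {v : Fin 3 → K} {a b c : K} (h0 : v 0 = a) (h1 : v 1 = b) (h2 : v 2 = c) :
    v = ![a, b, c] := by
  ext i; fin_cases i <;> assumption

theorem quadric_formB : quadric (formB K) = conic K := by
  ext p
  induction p using Projectivization.ind with | h v hv
  rw [mk_mem_quadric, formB_apply]
  constructor
  · intro h
    by_cases hx : v 0 = 0
    · have hz : v 2 = 0 := by simpa [hx] using h
      left
      rw [Set.mem_singleton_iff, Projectivization.mk_eq_mk_iff']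
      exact ⟨v 1, by ext i; fin_cases i <;> simp [hx, hz]⟩
    · right
      refine ⟨v 2 / v 0, ?_⟩
      change Projectivization.mk K _ _ = _
      rw [Projectivization.mk_eq_mk_iff']
      refine ⟨(v 0)⁻¹, ?_⟩
      have h1 : v 1 = - (v 2 * v 2) / v 0 := by
        rw [eq_div_iff hx]; linear_combination h
      ext i; fin_cases i
      · simp [hx]
      · simp only [Fin.mk_one, Pi.smul_apply, smul_eq_mul, Matrix.cons_val_one,
          Matrix.cons_val_zero]
        rw [h1]; field_simp
      · simp [div_eq_inv_mul]
  · rw [← formB_apply, ← mk_mem_quadric hv]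
    rintro (h | ⟨t, h⟩)
    · rw [Set.mem_singleton_iff.1 h, mk_mem_quadric, formB_apply]
      simp
    · rw [← h]
      change Projectivization.mk K _ _ ∈ _
      rw [mk_mem_quadric, formB_apply]
      simp [_root_.sq]

theorem mk_mem_conic {v : Fin 3 → K} (hv : v ≠ 0) :
    Projectivization.mk K v hv ∈ conic K ↔ formB K v = 0 := by
  rw [← quadric_formB, mk_mem_quadric]

/-- The tangent at `u` meets the conic only in `u`. -/
theorem conic_inter_tangent {u w : Fin 3 → K} (hu0 : u ≠ 0) (hu : formB K u = 0)
    (hw : formB K w ≠ 0) (h : polar (formB K) u w = 0) :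
    IsLine (Submodule.span K {u, w}) ∧
      (conic K ∩ pointsOn (Submodule.span K {u, w})).ncard = 1 := by
  constructor
  · refine isLine_span ((LinearIndependent.pair_iff' hu0).2 ?_)
    rintro a rfl
    simp [formB_smul, hu] at hw
  · rw [Set.ncard_eq_one]
    refine ⟨Projectivization.mk K u hu0, ?_⟩
    ext p
    induction p using Projectivization.ind with | h v hv
    rw [Set.mem_inter_iff, mk_mem_conic, mk_mem_pointsOn, Submodule.mem_span_pair,
      Set.mem_singleton_iff, Projectivization.mk_eq_mk_iff']
    constructor
    · rintro ⟨hB, a, b, rfl⟩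
      rw [map_lin, hu, h] at hB
      have hb : b = 0 := by simpa [hw] using hB
      exact ⟨a, by simp [hb]⟩
    · rintro ⟨a, rfl⟩
      exact ⟨by rw [formB_smul, hu, mul_zero], a, 0, by simp⟩

/-- The points all of whose lines meet the conic in zero or two points are the points at which `B`
takes nonsquare values. -/
theorem mk_mem_evenPoints {v : Fin 3 → K} (hv : v ≠ 0) :
    Projectivization.mk K v hv ∈ evenPoints K ↔ ¬ IsSquare (formB K v) := by
  constructor
  · rintro h ⟨d, hd⟩
    have key : ∃ L : Submodule K (Fin 3 → K), IsLine L ∧ v ∈ L ∧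
        (conic K ∩ pointsOn L).ncard = 1 := by
      by_cases hd0 : d = 0
      · rw [hd0, mul_zero] at hd
        have : ∃ w, formB K w ≠ 0 ∧ polar (formB K) v w = 0 := by
          by_cases hx : v 0 = 0
          · have hz : v 2 = 0 := by simpa [hx, formB_apply] using hd
            exact ⟨![0, 0, 1], by simp [formB_apply], by simp [polar_formB, hx, hz]⟩
          · refine ⟨![0, - (2 * v 2) / v 0, 1], by simp [formB_apply], ?_⟩
            simp only [polar_formB, Matrix.cons_val_one, Matrix.cons_val_zero, Matrix.cons_val]
            field_simp
            ring
        obtain ⟨w, hw, hvw⟩ := this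
        obtain ⟨h1, h2⟩ := conic_inter_tangent hv hd hw hvw
        exact ⟨_, h1, Submodule.mem_span_of_mem (by simp), h2⟩
      · have hB : formB K v ≠ 0 := by rw [hd]; exact mul_ne_zero hd0 hd0
        have : ∃ u, u ≠ 0 ∧ formB K u = 0 ∧ polar (formB K) u v = 0 := by
          by_cases hy : v 1 = 0
          · refine ⟨![1, 0, 0], fun h => one_ne_zero (α := K) (congrFun h 0), ?_, ?_⟩
            · simp [formB_apply]
            · simp [polar_formB, hy]
          · rw [formB_apply] at hd
            refine ⟨![(d - v 2) ^ 2, - v 1 ^ 2, (d - v 2) * v 1], fun h => ?_, ?_, ?_⟩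
            · have := congrFun h 1
              simp [hy] at this
            · simp only [formB_apply, Matrix.cons_val_one, Matrix.cons_val_zero, Matrix.cons_val]
              ring
            · simp only [polar_formB, Matrix.cons_val_one, Matrix.cons_val_zero, Matrix.cons_val]
              linear_combination (-v 1) * hd
        obtain ⟨u, hu0, hu, huv⟩ := this
        obtain ⟨h1, h2⟩ := conic_inter_tangent hu0 hu hB huv
        exact ⟨_, h1, Submodule.mem_span_of_mem (by simp), h2⟩
    obtain ⟨L, hL, hvL, h1⟩ := key
    rcases h L hL ((mk_mem_pointsOn hv).2 hvL) with h | h <;> omega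
  · intro hsq L hL hvL
    rw [mk_mem_pointsOn] at hvL
    rcases Set.eq_empty_or_nonempty (conic K ∩ pointsOn L) with he | ⟨p, hp⟩
    · left; rw [he, Set.ncard_empty]
    right
    induction p using Projectivization.ind with | h u hu0
    rw [Set.mem_inter_iff, mk_mem_conic, mk_mem_pointsOn] at hp
    obtain ⟨hu, huL⟩ := hp
    have huv : polar (formB K) u v ≠ 0 := fun h => hsq (isSquare_of_polar_eq_zero hu0 hu h)
    have hli : LinearIndependent K ![u, v] := by
      refine (LinearIndependent.pair_iff' hu0).2 ?_
      rintro a rfl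
      exact hsq ⟨0, by rw [formB_smul, hu]; ring⟩
    have hspan : Submodule.span K {u, v} = L := (hL.eq_span huL hvL hli).symm
    have hpair := LinearIndependent.pair_iff.1 hli
    -- The second point of the secant.
    set k := - formB K v / polar (formB K) u v with hk
    have hw0 : k • u + v ≠ 0 := fun h => by
      have := hpair k 1 (by rw [one_smul, h])
      exact one_ne_zero this.2
    rw [Set.ncard_eq_two]
    refine ⟨Projectivization.mk K u hu0, Projectivization.mk K (k • u + v) hw0, ?_, ?_⟩
    · rw [ne_eq, Projectivization.mk_eq_mk_iff']
      rintro ⟨a, ha⟩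
      have := hpair (a * k - 1) a (by rw [← sub_eq_zero] at ha; rw [← ha]; module)
      rw [this.2] at this
      simp at this
    · ext p
      induction p using Projectivization.ind with | h w hw
      rw [Set.mem_inter_iff, mk_mem_conic, mk_mem_pointsOn, ← hspan, Submodule.mem_span_pair,
        Set.mem_insert_iff, Set.mem_singleton_iff, Projectivization.mk_eq_mk_iff',
        Projectivization.mk_eq_mk_iff']
      constructor
      · rintro ⟨hB, a, b, rfl⟩
        rw [map_lin, hu] at hB
        by_cases hb : b = 0
        · left; exact ⟨a, by simp [hb]⟩
        · right
          refine ⟨b, ?_⟩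
          have h1 : b * formB K v + a * polar (formB K) u v = 0 := by
            refine (mul_eq_zero.1 (?_ : b * (b * formB K v + a * polar (formB K) u v) = 0)).resolve_left
              hb
            linear_combination hB
          have h2 : a = b * k := by
            rw [hk]; field_simp; linear_combination h1
          rw [h2]; module
      · rintro (⟨a, rfl⟩ | ⟨a, rfl⟩)
        · exact ⟨by rw [formB_smul, hu, mul_zero], a, 0, by simp⟩
        · refine ⟨?_, a * k, a, by module⟩
          rw [formB_smul, map_add_eq, polar_smul_left, formB_smul, hu, hk]
          simp only [smul_eq_mul]
          field_simp
          ring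

end Conic

/-! ### Elements of `Ω₃` and its transitivity on nonsingular vectors -/

section Omega
open scoped commutatorElement

variable {K : Type*} [Field K]

/-- The unipotent isometry of `B` that fixes `(0, 1, 0)` and maps `(1, 0, 0)` to
`(1, -t ^ 2, t)`. -/
def upper (t : K) : (Fin 3 → K) ≃ₗ[K] (Fin 3 → K) where
  toFun v := ![v 0, v 1 - 2 * t * v 2 - t ^ 2 * v 0, v 2 + t * v 0]
  map_add' v w := by ext i; fin_cases i <;> simp <;> ring
  map_smul' a v := by ext i; fin_cases i <;> simp <;> ring
  invFun v := ![v 0, v 1 + 2 * t * v 2 - t ^ 2 * v 0, v 2 - t * v 0]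
  left_inv v := by ext i; fin_cases i <;> simp; ring
  right_inv v := by ext i; fin_cases i <;> simp; ring

/-- The unipotent isometry of `B` that fixes `(1, 0, 0)` and maps `(0, 1, 0)` to
`(-t ^ 2, 1, t)`. -/
def lower (t : K) : (Fin 3 → K) ≃ₗ[K] (Fin 3 → K) where
  toFun v := ![v 0 - 2 * t * v 2 - t ^ 2 * v 1, v 1, v 2 + t * v 1]
  map_add' v w := by ext i; fin_cases i <;> simp <;> ring
  map_smul' a v := by ext i; fin_cases i <;> simp <;> ring
  invFun v := ![v 0 + 2 * t * v 2 - t ^ 2 * v 1, v 1, v 2 - t * v 1]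
  left_inv v := by ext i; fin_cases i <;> simp; ring
  right_inv v := by ext i; fin_cases i <;> simp; ring

/-- The isometry `(X, Y, Z) ↦ (a X, a⁻¹ Y, Z)` of `B`. -/
def torus (a : Kˣ) : (Fin 3 → K) ≃ₗ[K] (Fin 3 → K) where
  toFun v := ![a * v 0, ↑a⁻¹ * v 1, v 2]
  map_add' v w := by ext i; fin_cases i <;> simp <;> ring
  map_smul' c v := by ext i; fin_cases i <;> simp <;> ring
  invFun v := ![↑a⁻¹ * v 0, a * v 1, v 2]
  left_inv v := by ext i; fin_cases i <;> simp
  right_inv v := by ext i; fin_cases i <;> simp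

/-- The isometry of `B` that exchanges the first two coordinates. -/
def swap : (Fin 3 → K) ≃ₗ[K] (Fin 3 → K) where
  toFun v := ![v 1, v 0, v 2]
  map_add' v w := by ext i; fin_cases i <;> simp
  map_smul' c v := by ext i; fin_cases i <;> simp
  invFun v := ![v 1, v 0, v 2]
  left_inv v := by ext i; fin_cases i <;> simp
  right_inv v := by ext i; fin_cases i <;> simp

theorem upper_apply (t : K) (v : Fin 3 → K) :
    upper t v = ![v 0, v 1 - 2 * t * v 2 - t ^ 2 * v 0, v 2 + t * v 0] := rfl

theorem lower_apply (t : K) (v : Fin 3 → K) :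
    lower t v = ![v 0 - 2 * t * v 2 - t ^ 2 * v 1, v 1, v 2 + t * v 1] := rfl

theorem torus_apply (a : Kˣ) (v : Fin 3 → K) : torus a v = ![a * v 0, ↑a⁻¹ * v 1, v 2] := rfl

theorem swap_apply (v : Fin 3 → K) : swap v = ![v 1, v 0, v 2] := rfl

theorem upper_mem_orthogonalGroup (t : K) : upper t ∈ orthogonalGroup (formB K) := by
  intro v; simp [formB_apply, upper_apply]; ring

theorem lower_mem_orthogonalGroup (t : K) : lower t ∈ orthogonalGroup (formB K) := by
  intro v; simp [formB_apply, lower_apply]; ring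

theorem torus_mem_orthogonalGroup (a : Kˣ) : torus a ∈ orthogonalGroup (formB K) := by
  intro v; simp [formB_apply, torus_apply]; field_simp

theorem swap_mem_orthogonalGroup : swap ∈ orthogonalGroup (formB K) := by
  intro v; simp [formB_apply, swap_apply]; ring

theorem omegaThree_le : omegaThree K ≤ orthogonalGroup (formB K) :=
  Subgroup.commutator_le.2 fun _ ha _ hb =>
    mul_mem (mul_mem (mul_mem ha hb) (inv_mem ha)) (inv_mem hb)

theorem formB_omegaThree {g : (Fin 3 → K) ≃ₗ[K] (Fin 3 → K)} (hg : g ∈ omegaThree K)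
    (v : Fin 3 → K) : formB K (g v) = formB K v :=
  omegaThree_le hg v

/-- The commutator of two isometries, recognized from its defining relation. -/
theorem mem_omegaThree_of_mul_eq {a b g : (Fin 3 → K) ≃ₗ[K] (Fin 3 → K)}
    (ha : a ∈ orthogonalGroup (formB K)) (hb : b ∈ orthogonalGroup (formB K))
    (h : ∀ v, a (b v) = g (b (a v))) : g ∈ omegaThree K := by
  have hg : g = ⁅a, b⁆ := by
    rw [commutatorElement_def, eq_mul_inv_iff_mul_eq, eq_mul_inv_iff_mul_eq]
    exact LinearEquiv.ext fun v => (h v).symm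
  rw [hg]
  exact Subgroup.commutator_mem_commutator ha hb

theorem upper_mem_omegaThree (h2 : (2 : K) ≠ 0) (t : K) : upper t ∈ omegaThree K := by
  refine mem_omegaThree_of_mul_eq (torus_mem_orthogonalGroup (-1))
    (upper_mem_orthogonalGroup (-(t / 2))) fun v => ?_
  ext i; fin_cases i <;> simp [upper_apply, torus_apply] <;> field_simp <;> ring

theorem lower_mem_omegaThree (h2 : (2 : K) ≠ 0) (t : K) : lower t ∈ omegaThree K := by
  refine mem_omegaThree_of_mul_eq (torus_mem_orthogonalGroup (-1))
    (lower_mem_orthogonalGroup (-(t / 2))) fun v => ?_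
  ext i; fin_cases i <;> simp [lower_apply, torus_apply] <;> field_simp <;> ring

theorem torus_sq_mem_omegaThree (a : Kˣ) : torus (a * a) ∈ omegaThree K := by
  refine mem_omegaThree_of_mul_eq (torus_mem_orthogonalGroup a) swap_mem_orthogonalGroup
    fun v => ?_
  ext i; fin_cases i <;> simp [swap_apply, torus_apply] <;> field_simp

/-- For nonsquare `c` and square `-1`, the norm form `1 - c r ^ 2` takes nonsquare values. -/
theorem exists_one_sub_mul_sq_not_isSquare (h2 : (2 : K) ≠ 0) (hneg : IsSquare (-1 : K)) {c : K}
    (hc : ¬ IsSquare c) : ∃ r : K, ¬ IsSquare (1 - c * r ^ 2) := by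
  have hc0 : c ≠ 0 := by rintro rfl; exact hc ⟨0, by simp⟩
  have hc1 : c - 1 ≠ 0 := by
    intro h; exact hc ⟨1, by linear_combination h⟩
  obtain ⟨i, hi⟩ := hneg
  -- With `s = (1 - 1 / c) / 2` and `r = (-1 / c - 1) / 2` one has `1 - c r ^ 2 = - c s ^ 2`.
  refine ⟨(-1 / c - 1) / 2, ?_⟩
  rintro ⟨d, hd⟩
  refine hc ⟨i * d / ((c - 1) / (2 * c)), ?_⟩
  have h : 1 - c * ((-1 / c - 1) / 2) ^ 2 = - c * ((c - 1) / (2 * c)) ^ 2 := by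
    field_simp; ring
  have hs : (c - 1) / (2 * c) ≠ 0 := div_ne_zero hc1 (mul_ne_zero h2 hc0)
  rw [h] at hd
  field_simp at hd ⊢
  linear_combination (-1 : K) * hd + (4 * d ^ 2 * c) * hi

/-- `Ω₃` is transitive on the vectors with a given nonsquare value of `B`. -/
theorem exists_omegaThree_of_formB_eq (h2 : (2 : K) ≠ 0) (hneg : IsSquare (-1 : K))
    (hprod : ∀ a b : K, ¬ IsSquare a → ¬ IsSquare b → IsSquare (a * b)) {c : K}
    (hc : ¬ IsSquare c) {v w : Fin 3 → K} (hv : formB K v = c) (hw : formB K w = c) :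
    ∃ g ∈ omegaThree K, g v = w := by
  have h0 (v : Fin 3 → K) (hv : formB K v = c) : v 0 ≠ 0 := by
    intro h
    exact hc ⟨v 2, by rw [← hv, formB_apply, h]; ring⟩
  -- Every vector can be moved to `(1, c, 0)`, directly if its first coordinate is a square.
  have hsq (v : Fin 3 → K) (hv : formB K v = c) (hx : IsSquare (v 0)) :
      ∃ g ∈ omegaThree K, g v = ![1, c, 0] := by
    have hx0 := h0 v hv
    obtain ⟨a, ha⟩ := hx
    have ha0 : a ≠ 0 := by rintro rfl; simp [ha] at hx0
    refine ⟨torus ((Units.mk0 a ha0)⁻¹ * (Units.mk0 a ha0)⁻¹) * upper (- (v 2 / v 0)),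
      mul_mem (torus_sq_mem_omegaThree _) (upper_mem_omegaThree h2 _), ?_⟩
    rw [formB_apply] at hv
    rw [LinearEquiv.mul_apply, upper_apply, torus_apply]
    refine vec_ext ?_ ?_ ?_
    · simp [ha]; field_simp
    · simp [ha] at hv ⊢; field_simp; linear_combination hv
    · simp; field_simp; ring
  have hall (v : Fin 3 → K) (hv : formB K v = c) : ∃ g ∈ omegaThree K, g v = ![1, c, 0] := by
    have hx0 := h0 v hv
    by_cases hx : IsSquare (v 0)
    · exact hsq v hv hx
    -- Otherwise the first coordinate is first multiplied by a nonsquare `1 - c r ^ 2`.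
    obtain ⟨r, hr⟩ := exists_one_sub_mul_sq_not_isSquare h2 hneg hc
    set w := (lower (v 0 * r) * upper (- (v 2 / v 0))) v with hw
    have hgm : lower (v 0 * r) * upper (- (v 2 / v 0)) ∈ omegaThree K :=
      mul_mem (lower_mem_omegaThree h2 _) (upper_mem_omegaThree h2 _)
    have hwB : formB K w = c := by rw [hw, formB_omegaThree hgm, hv]
    have hw0 : w 0 = v 0 * (1 - c * r ^ 2) := by
      rw [formB_apply] at hv
      rw [hw, LinearEquiv.mul_apply, upper_apply, lower_apply, ← hv]
      simp
      field_simp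
      ring
    obtain ⟨g, hg, hgw⟩ := hsq w hwB (by rw [hw0]; exact hprod _ _ hx hr)
    exact ⟨g * _, mul_mem hg hgm, hgw⟩
  obtain ⟨g, hg, hgv⟩ := hall v hv
  obtain ⟨g', hg', hgw⟩ := hall w hw
  refine ⟨g'⁻¹ * g, mul_mem (inv_mem hg') hg, ?_⟩
  rw [LinearEquiv.mul_apply, hgv, ← hgw, ← LinearEquiv.mul_apply, inv_mul_cancel]
  rfl

end Omega

/-! ### Square classes of singular vectors -/

section SquareClass
open scoped Classical commutatorElement

variable {K : Type*} [Field K] [Fintype K]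

theorem isSquare_mul_of_not_isSquare {a b : K} (ha : ¬ IsSquare a) (hb : ¬ IsSquare b) :
    IsSquare (a * b) := by
  have ha0 : a ≠ 0 := by rintro rfl; exact ha ⟨0, by simp⟩
  have hb0 : b ≠ 0 := by rintro rfl; exact hb ⟨0, by simp⟩
  rw [← quadraticChar_one_iff_isSquare (mul_ne_zero ha0 hb0), map_mul,
    quadraticChar_neg_one_iff_not_isSquare.2 ha, quadraticChar_neg_one_iff_not_isSquare.2 hb]
  norm_num

/-- The square class of a singular vector: `1` on the vectors `(a ^ 2, -b ^ 2, a b)` and `-1` on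
their nonsquare multiples, when `-1` is a square. -/
def tau (v : Fin 3 → K) : ℤ :=
  if v 0 = 0 then quadraticChar K (v 1) else quadraticChar K (v 0)

theorem tau_zero : tau (0 : Fin 3 → K) = 0 := by simp [tau]

theorem tau_smul (a : K) (v : Fin 3 → K) : tau (a • v) = quadraticChar K a * tau v := by
  by_cases ha : a = 0
  · simp [ha, tau]
  · by_cases hv : v 0 = 0 <;> simp [tau, ha, hv, quadraticCharFun_mul]

theorem tau_eq_or {v : Fin 3 → K} (hv0 : v ≠ 0) (hv : formB K v = 0) : tau v = 1 ∨ tau v = -1 := by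
  by_cases hx : v 0 = 0
  · have hz : v 2 = 0 := by simpa [hx, formB_apply] using hv
    have hy : v 1 ≠ 0 := by
      intro hy
      exact hv0 (by ext i; fin_cases i <;> assumption)
    rw [tau, if_pos hx]
    exact quadraticChar_dichotomy hy
  · rw [tau, if_neg hx]
    exact quadraticChar_dichotomy hx

/-- The value of the polar form at two singular vectors determines whether their square classes
agree. -/
theorem quadraticChar_polar (hneg : IsSquare (-1 : K)) {u w : Fin 3 → K} (hu : formB K u = 0)
    (hw : formB K w = 0) (h : polar (formB K) u w ≠ 0) :
    quadraticChar K (polar (formB K) u w) = tau u * tau w := by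
  rw [formB_apply] at hu hw
  rw [polar_formB] at h ⊢
  by_cases hx : u 0 = 0
  · have hz : u 2 = 0 := by simpa [hx] using hu
    have hw0 : w 0 ≠ 0 := by rintro h0; simp [hx, hz, h0] at h
    simp [tau, hx, hz, hw0, quadraticCharFun_mul, mul_comm]
  by_cases hx' : w 0 = 0
  · have hz : w 2 = 0 := by simpa [hx'] using hw
    simp [tau, hx, hz, hx', quadraticCharFun_mul]
  rw [tau, tau, if_neg hx, if_neg hx']
  have h1 : (u 0 * w 1 + w 0 * u 1 + 2 * (u 2 * w 2)) * (u 0 * w 0) =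
      -1 * (u 0 * w 2 - w 0 * u 2) ^ 2 := by
    linear_combination (w 0 ^ 2) * hu + (u 0 ^ 2) * hw
  have h2 : u 0 * w 2 - w 0 * u 2 ≠ 0 := by
    intro h0
    rw [h0] at h1
    simp [hx, hx'] at h1
    exact h h1
  have h3 := congrArg (quadraticChar K) h1
  rw [map_mul, map_mul, map_mul, quadraticChar_sq_one' h2,
    (quadraticChar_one_iff_isSquare (neg_ne_zero.2 one_ne_zero)).2 hneg] at h3
  rcases quadraticChar_dichotomy hx with h4 | h4 <;>
    rcases quadraticChar_dichotomy hx' with h5 | h5 <;> rw [h4, h5] at h3 ⊢ <;> linarith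

/-- Each isometry of `B` either preserves or exchanges the two square classes of singular
vectors. -/
theorem exists_sign_tau (hneg : IsSquare (-1 : K)) {g : (Fin 3 → K) ≃ₗ[K] (Fin 3 → K)}
    (hg : g ∈ orthogonalGroup (formB K)) :
    ∃ θ : ℤ, θ * θ = 1 ∧ ∀ v, formB K v = 0 → tau (g v) = θ * tau v := by
  have hg' : ∀ v, formB K (g v) = formB K v := hg
  have hpol (u w : Fin 3 → K) : polar (formB K) (g u) (g w) = polar (formB K) u w := by
    rw [polar, ← map_add, hg', hg', hg', polar]
  have hmul {u w : Fin 3 → K} (hu : formB K u = 0) (hw : formB K w = 0)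
      (h : polar (formB K) u w ≠ 0) : tau (g u) * tau (g w) = tau u * tau w := by
    rw [← quadraticChar_polar hneg hu hw h, ← quadraticChar_polar hneg (by rw [hg', hu])
      (by rw [hg', hw]) (by rwa [hpol]), hpol]
  have ht {v : Fin 3 → K} (hv0 : v ≠ 0) (hv : formB K v = 0) : tau (g v) * tau (g v) = 1 := by
    rcases tau_eq_or (v := g v) (by simpa using hv0) (by rw [hg', hv]) with h | h <;> rw [h] <;>
      norm_num
  set e₁ : Fin 3 → K := ![1, 0, 0] with he₁
  set e₂ : Fin 3 → K := ![0, 1, 0] with he₂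
  have h1 : formB K e₁ = 0 := by simp [formB_apply, he₁]
  have h2 : formB K e₂ = 0 := by simp [formB_apply, he₂]
  have h10 : e₁ ≠ 0 := fun h => one_ne_zero (α := K) (congrFun h 0)
  have t1 : tau e₁ = 1 := by simp [tau, he₁]
  have t2 : tau e₂ = 1 := by simp [tau, he₂]
  refine ⟨tau (g e₁), ht h10 h1, fun v hv => ?_⟩
  by_cases hv1 : polar (formB K) e₁ v = 0
  · obtain ⟨k, rfl⟩ := exists_smul_of_polar_eq_zero h10 h1 hv hv1
    rw [map_smul, tau_smul, tau_smul, t1]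
    ring
  · have := hmul h1 hv hv1
    rw [t1] at this
    linear_combination tau (g e₁) * this - tau (g v) * ht h10 h1

/-- The group `Ω₃` preserves the square classes of singular vectors. -/
theorem tau_omegaThree (hneg : IsSquare (-1 : K)) {g : (Fin 3 → K) ≃ₗ[K] (Fin 3 → K)}
    (hg : g ∈ omegaThree K) : ∀ v, formB K v = 0 → tau (g v) = tau v := by
  let T : Subgroup ((Fin 3 → K) ≃ₗ[K] (Fin 3 → K)) :=
    { carrier := {g | g ∈ orthogonalGroup (formB K) ∧ ∀ v, formB K v = 0 → tau (g v) = tau v}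
      mul_mem' := fun {a b} ha hb => ⟨mul_mem ha.1 hb.1, fun v hv => by
        rw [LinearEquiv.mul_apply, ha.2 _ ((hb.1 v).trans hv), hb.2 v hv]⟩
      one_mem' := ⟨one_mem _, fun _ _ => rfl⟩
      inv_mem' := fun {a} ha => ⟨inv_mem ha.1, fun v hv => by
        rw [← ha.2 _ ((inv_mem ha.1 v).trans hv), ← LinearEquiv.mul_apply, mul_inv_cancel]
        rfl⟩ }
  suffices h : omegaThree K ≤ T from (h hg).2
  refine Subgroup.commutator_le.2 fun a ha b hb => ⟨?_, fun v hv => ?_⟩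
  · exact omegaThree_le (Subgroup.commutator_mem_commutator ha hb)
  obtain ⟨θ, hθ, h⟩ := exists_sign_tau hneg ha
  obtain ⟨θ', hθ', h'⟩ := exists_sign_tau hneg hb
  set w := a⁻¹ (b⁻¹ v) with hw
  have hv' : formB K (b⁻¹ v) = 0 := (inv_mem hb v).trans hv
  have hw0 : formB K w = 0 := (inv_mem ha _).trans hv'
  have e1 : tau (b⁻¹ v) = θ * tau w := by
    rw [← h w hw0, hw, ← LinearEquiv.mul_apply, mul_inv_cancel]; rfl
  have e2 : tau v = θ' * tau (b⁻¹ v) := by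
    rw [← h' _ hv', ← LinearEquiv.mul_apply, mul_inv_cancel]; rfl
  have e3 : ⁅a, b⁆ v = a (b w) := rfl
  rw [e3, h _ ((hb w).trans hw0), h' _ hw0, e2, e1]
  ring

/-- `Ω₃` is transitive on each square class of nonzero singular vectors. -/
theorem exists_omegaThree_of_tau (h2 : (2 : K) ≠ 0) (hneg : IsSquare (-1 : K)) {v : Fin 3 → K}
    (hv : formB K v = 0) (ht : tau v = 1) : ∃ g ∈ omegaThree K, g ![1, 0, 0] = v := by
  have hv' := hv
  rw [formB_apply] at hv
  by_cases hx : v 0 = 0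
  · have hz : v 2 = 0 := by simpa [hx] using hv
    rw [tau, if_pos hx] at ht
    have hy : v 1 ≠ 0 := by intro h; simp [h] at ht
    obtain ⟨b, hb⟩ := hneg.mul ((quadraticChar_one_iff_isSquare hy).1 ht)
    have hb0 : b ≠ 0 := by rintro rfl; simp [hy] at hb
    refine ⟨lower 1 * upper 1 * torus (Units.mk0 b hb0 * Units.mk0 b hb0),
      mul_mem (mul_mem (lower_mem_omegaThree h2 _) (upper_mem_omegaThree h2 _))
        (torus_sq_mem_omegaThree _), ?_⟩
    rw [LinearEquiv.mul_apply, LinearEquiv.mul_apply, torus_apply, upper_apply, lower_apply]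
    ext i; fin_cases i
    · simp [hx]; ring
    · simp; linear_combination hb
    · simp [hz]
  · rw [tau, if_neg hx] at ht
    obtain ⟨a, ha⟩ := (quadraticChar_one_iff_isSquare hx).1 ht
    have ha0 : a ≠ 0 := by rintro rfl; simp at ha; exact hx ha
    refine ⟨upper (v 2 / v 0) * torus (Units.mk0 a ha0 * Units.mk0 a ha0),
      mul_mem (upper_mem_omegaThree h2 _) (torus_sq_mem_omegaThree _), ?_⟩
    rw [LinearEquiv.mul_apply, torus_apply, upper_apply]
    ext i; fin_cases i
    · simp [ha]
    · simp [ha] at hv ⊢; field_simp; linear_combination -hv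
    · simp [ha]; field_simp

end SquareClass

/-! ### Orbits of `Ω₃` on points -/

section Orbits
open scoped Classical

variable (F : Type*) {K : Type*} [Field F] [Field K] [Fintype K] [Algebra F K]

omit [Fintype K] in
theorem mem_orbit_mk {u v : Fin 3 → K} (hu : u ≠ 0) (hv : v ≠ 0) :
    Projectivization.mk F v hv ∈ MulAction.orbit (omegaThree K) (Projectivization.mk F u hu) ↔
      ∃ g ∈ omegaThree K, ∃ a : F, v = algebraMap F K a • g u := by
  constructor
  · rintro ⟨⟨g, hg⟩, h⟩
    obtain ⟨a, ha⟩ := (Projectivization.mk_eq_mk_iff' _ _ _ _ _).1 h.symm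
    exact ⟨g, hg, a, by rw [algebraMap_smul]; exact ha.symm⟩
  · rintro ⟨g, hg, a, h⟩
    refine ⟨⟨g, hg⟩, Eq.symm ?_⟩
    exact (Projectivization.mk_eq_mk_iff' _ _ _ _ _).2 ⟨a, by rw [h, algebraMap_smul]; rfl⟩

variable {F} (h2 : (2 : K) ≠ 0) (hneg : IsSquare (-1 : K))
include h2 hneg

/-- When the scalars are squares in `K`, the orbit of `(1 : 0 : 0)` consists of one of the
two square classes of singular vectors. -/
theorem mk_mem_orbit_singular (hF : ∀ a : F, IsSquare (algebraMap F K a)) {v : Fin 3 → K}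
    (hv : v ≠ 0) :
    Projectivization.mk F v hv ∈ MulAction.orbit (omegaThree K) (point F (0 : K) 0) ↔
      formB K v = 0 ∧ tau v = 1 := by
  rw [point, mem_orbit_mk]
  have h1 : formB K ![1, 0, 0] = 0 := by simp [formB_apply]
  constructor
  · rintro ⟨g, hg, a, rfl⟩
    refine ⟨by rw [formB_smul, formB_omegaThree hg, h1, mul_zero], ?_⟩
    have ha : algebraMap F K a ≠ 0 := fun ha => hv (by rw [ha, zero_smul])
    rw [tau_smul, tau_omegaThree hneg hg _ h1, (quadraticChar_one_iff_isSquare ha).2 (hF a)]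
    simp [tau]
  · rintro ⟨hB, ht⟩
    obtain ⟨g, hg, rfl⟩ := exists_omegaThree_of_tau h2 hneg hB ht
    exact ⟨g, hg, 1, by simp⟩

/-- The orbit of `(1 : 1 : ε)` consists of the points at which `B` takes values in
`(ε ^ 2 + 1) a ^ 2`, with `a` in the field of scalars. -/
theorem mk_mem_orbit_nonsingular {ε : K} (hε : ¬ IsSquare (ε ^ 2 + 1)) {v : Fin 3 → K}
    (hv : v ≠ 0) :
    Projectivization.mk F v hv ∈ MulAction.orbit (omegaThree K) (point F 1 ε) ↔
      ∃ a : F, a ≠ 0 ∧ formB K v = algebraMap F K a * algebraMap F K a * (ε ^ 2 + 1) := by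
  rw [point, mem_orbit_mk]
  have h1 : formB K ![1, 1, ε] = ε ^ 2 + 1 := by simp [formB_apply]; ring
  constructor
  · rintro ⟨g, hg, a, rfl⟩
    refine ⟨a, ?_, by rw [formB_smul, formB_omegaThree hg, h1]⟩
    rintro rfl
    simp at hv
  · rintro ⟨a, ha, hB⟩
    have ha' : algebraMap F K a ≠ 0 := by simpa using ha
    obtain ⟨g, hg, hgv⟩ := exists_omegaThree_of_formB_eq h2 hneg
      (fun _ _ => isSquare_mul_of_not_isSquare) hε h1
      (w := (algebraMap F K a)⁻¹ • v) (by rw [formB_smul, hB]; field_simp)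
    exact ⟨g, hg, a, by rw [hgv, smul_inv_smul₀ ha']⟩

theorem orbit_eq_conic :
    MulAction.orbit (omegaThree K) (point K (0 : K) 0) = conic K := by
  ext p
  constructor
  · induction p using Projectivization.ind with | h v hv
    rw [point, mem_orbit_mk, mk_mem_conic]
    rintro ⟨g, hg, a, rfl⟩
    rw [formB_smul, formB_omegaThree hg]
    simp [formB_apply]
  · -- The chosen representatives of the points of the conic all have square class `1`.
    have key (v : Fin 3 → K) (hv : v ≠ 0) (hB : formB K v = 0) (ht : tau v = 1) :
        Projectivization.mk K v hv ∈ MulAction.orbit (omegaThree K) (point K (0 : K) 0) := by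
      rw [point, mem_orbit_mk]
      obtain ⟨g, hg, rfl⟩ := exists_omegaThree_of_tau h2 hneg hB ht
      exact ⟨g, hg, 1, by simp⟩
    rintro (rfl | ⟨t, rfl⟩)
    · exact key _ _ (by simp [formB_apply]) (by simp [tau])
    · exact key _ _ (by simp [formB_apply, _root_.sq]) (by simp [tau])

theorem orbit_eq_evenPoints {ε : K} (hε : ¬ IsSquare (ε ^ 2 + 1)) :
    MulAction.orbit (omegaThree K) (point K 1 ε) = evenPoints K := by
  ext p
  induction p using Projectivization.ind with | h v hv
  rw [mk_mem_orbit_nonsingular h2 hneg hε, mk_mem_evenPoints]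
  have hc : ε ^ 2 + 1 ≠ 0 := fun h => hε ⟨0, by rw [h, mul_zero]⟩
  constructor
  · rintro ⟨a, ha, h⟩ ⟨d, hd⟩
    change a ≠ 0 at ha
    refine hε ⟨d / a, ?_⟩
    rw [hd, Algebra.algebraMap_self_apply] at h
    field_simp
    linear_combination -h
  · intro h
    obtain ⟨d, hd⟩ := isSquare_mul_of_not_isSquare h hε
    have hd0 : d ≠ 0 := by
      rintro rfl
      rcases mul_eq_zero.1 (hd.trans (mul_zero 0)) with h' | h'
      · exact h ⟨0, by rw [h', mul_zero]⟩
      · exact hc h'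
    refine ⟨d / (ε ^ 2 + 1), div_ne_zero hd0 hc, ?_⟩
    rw [Algebra.algebraMap_self_apply]
    field_simp
    linear_combination hd

omit h2 hneg [Fintype K] in
/-- In odd characteristic, `ε ^ 2 + 1` takes nonsquare values: each element of a finite field is
a sum of two squares. -/
theorem exists_sq_add_one_not_isSquare [Finite K] (h2 : (2 : K) ≠ 0) :
    ∃ ε : K, ε ≠ 0 ∧ ¬ IsSquare (ε ^ 2 + 1) := by
  have := Fintype.ofFinite K
  have hchar := ringChar_ne_two_of_two_ne_zero h2
  obtain ⟨n, hn⟩ := FiniteField.exists_nonsquare hchar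
  obtain ⟨a, b, hab⟩ := exists_diagonal_eq h2 (one_ne_zero (α := K)) (one_ne_zero (α := K)) n
  have hb : b ≠ 0 := by
    rintro rfl
    exact hn ⟨a, by rw [← hab]; ring⟩
  have hsq : ¬ IsSquare ((a / b) ^ 2 + 1) := by
    rintro ⟨d, hd⟩
    refine hn ⟨b * d, ?_⟩
    rw [← hab]
    field_simp at hd
    linear_combination hd
  refine ⟨a / b, ?_, hsq⟩
  intro h
  rw [h] at hsq
  exact hsq ⟨1, by ring⟩

end Orbits

/-! ### Squares in a quadratic extension -/

section QuadraticExtension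
open scoped Classical

variable {F K : Type*} [Field F] [Fintype F] [Field K] [Fintype K] [Algebra F K]

theorem card_eq_sq (hK : Module.finrank F K = 2) : Fintype.card K = Fintype.card F ^ 2 := by
  rw [← hK]; exact Module.card_eq_pow_finrank

theorem two_ne_zero_of_odd (h : Odd (Fintype.card F)) : (2 : F) ≠ 0 := by
  intro h0
  have h1 : ringChar F ∣ 2 := (ringChar.spec F 2).1 (by exact_mod_cast h0)
  have h2 : ringChar F = 2 :=
    ((Nat.dvd_prime Nat.prime_two).1 h1).resolve_left (CharP.ringChar_ne_one)
  have := FiniteField.even_card_of_char_two h2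
  rw [Nat.odd_iff] at h
  omega

omit [Fintype F] [Fintype K] in
theorem two_ne_zero_of_algebra (h2 : (2 : F) ≠ 0) : (2 : K) ≠ 0 := by
  have := (map_ne_zero (algebraMap F K)).2 h2
  rwa [map_ofNat] at this

/-- Every element of a finite field becomes a square in the quadratic extension. -/
theorem isSquare_algebraMap (h2 : (2 : F) ≠ 0) (hK : Module.finrank F K = 2) (a : F) :
    IsSquare (algebraMap F K a) := by
  by_cases ha : a = 0
  · exact ⟨0, by simp [ha]⟩
  have ha' : algebraMap F K a ≠ 0 := by simpa using ha
  rw [FiniteField.isSquare_iff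
    (ringChar_ne_two_of_two_ne_zero (two_ne_zero_of_algebra (K := K) h2)) ha', card_eq_sq hK]
  have hodd := FiniteField.odd_card_of_char_ne_two (ringChar_ne_two_of_two_ne_zero h2)
  obtain ⟨n, hn⟩ : ∃ n, Fintype.card F = 2 * n + 1 := ⟨Fintype.card F / 2, by omega⟩
  have h1 : Fintype.card F ^ 2 / 2 = (Fintype.card F - 1) * (n + 1) := by
    rw [hn, show 2 * n + 1 - 1 = 2 * n by omega,
      show (2 * n + 1) ^ 2 = 1 + 2 * (2 * n * (n + 1)) by ring]
    omega
  rw [h1, pow_mul, ← map_pow, FiniteField.pow_card_sub_one_eq_one a ha, map_one, one_pow]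

theorem isSquare_neg_one (h2 : (2 : F) ≠ 0) (hK : Module.finrank F K = 2) :
    IsSquare (-1 : K) := by
  have := isSquare_algebraMap h2 hK (-1 : F)
  rwa [map_neg, map_one] at this

/-- The signed sum of a diagonal binary form vanishes: the form has similitudes with nonsquare
multipliers. -/
theorem sum_quadraticChar_diagonal (h2 : (2 : F) ≠ 0) {α β : F} (hα : α ≠ 0) (hβ : β ≠ 0) :
    ∑ a : F, ∑ b : F, quadraticChar F (a * a * α + b * b * β) = 0 := by
  obtain ⟨n, hn⟩ := quadraticChar_exists_neg_one (ringChar_ne_two_of_two_ne_zero h2)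
  have hn0 : n ≠ 0 := by rintro rfl; simp at hn
  obtain ⟨c, d, hcd⟩ := exists_diagonal_eq h2 (one_ne_zero (α := F)) (div_ne_zero hβ hα) n
  have hcd' : α * c ^ 2 + β * d ^ 2 = α * n := by rw [← hcd]; field_simp
  -- The map with matrix `(c, -d β / α; d, c)` multiplies the form by the nonsquare `n`.
  let T : F × F → F × F := fun p => (c * p.1 - β / α * d * p.2, d * p.1 + c * p.2)
  have hT : Function.Injective T := by
    rintro ⟨a, b⟩ ⟨a', b'⟩ h
    rw [Prod.mk.injEq] at h
    obtain ⟨h1, h3⟩ := h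
    simp only at h1 h3
    field_simp at h1
    have e1 : α * n * (a - a') = 0 := by
      rw [← hcd']; linear_combination c * h1 + β * d * h3
    have e2 : α * n * (b - b') = 0 := by
      rw [← hcd']; linear_combination α * c * h3 - d * h1
    have hαn : α * n ≠ 0 := mul_ne_zero hα hn0
    exact Prod.ext (sub_eq_zero.1 ((mul_eq_zero.1 e1).resolve_left hαn))
      (sub_eq_zero.1 ((mul_eq_zero.1 e2).resolve_left hαn))
  have hsum := (Equiv.ofBijective T (Finite.injective_iff_bijective.1 hT)).sum_comp
    fun p : F × F => quadraticChar F (p.1 * p.1 * α + p.2 * p.2 * β)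
  have hmul (p : F × F) : quadraticChar F ((T p).1 * (T p).1 * α + (T p).2 * (T p).2 * β) =
      - quadraticChar F (p.1 * p.1 * α + p.2 * p.2 * β) := by
    have h : (T p).1 * (T p).1 * α + (T p).2 * (T p).2 * β =
        n * (p.1 * p.1 * α + p.2 * p.2 * β) := by
      simp only [T]
      field_simp
      linear_combination (p.1 ^ 2 * α + β * p.2 ^ 2) * hcd'
    rw [h, map_mul, hn, neg_one_mul]
  simp only [Equiv.ofBijective_apply, hmul, Finset.sum_neg_distrib] at hsum
  rw [← Fintype.sum_prod_type (f := fun p : F × F => quadraticChar F (p.1 * p.1 * α + p.2 * p.2 * β))]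
  omega

end QuadraticExtension

/-! ### The trace form and its Witt index -/

section TraceForm
open scoped Classical

variable {F K : Type*} [Field F] [Field K] [Algebra F K]

theorem traceForm_apply (ν : K) (v : Fin 3 → K) :
    traceForm F ν v = Algebra.trace F K (ν * formB K v) := rfl

theorem polar_traceForm (ν : K) (v w : Fin 3 → K) :
    polar (traceForm F ν) v w = Algebra.trace F K (ν * polar (formB K) v w) := by
  rw [polar, traceForm_apply, traceForm_apply, traceForm_apply, polar, mul_sub, mul_sub, map_sub,
    map_sub]

variable [Fintype F] [Fintype K]

theorem eq_zero_of_trace_mul_eq_zero {x : K} (h : ∀ y, Algebra.trace F K (x * y) = 0) : x = 0 :=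
  (traceForm_nondegenerate F K).1 x h

theorem exists_trace_mul_eq_one {x : K} (hx : x ≠ 0) : ∃ y, Algebra.trace F K (y * x) = 1 := by
  by_contra! h
  refine hx (eq_zero_of_trace_mul_eq_zero (F := F) fun y => ?_)
  by_contra h0
  refine h ((Algebra.trace F K (x * y))⁻¹ • y) ?_
  rw [smul_mul_assoc, map_smul, mul_comm y x, smul_eq_mul, inv_mul_cancel₀ h0]

theorem exists_trace_mul_eq_zero (hK : Module.finrank F K = 2) {c : K} (hc : c ≠ 0) :
    ∃ ν : K, ν ≠ 0 ∧ Algebra.trace F K (ν * c) = 0 := by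
  have hlt : Fintype.card F < Fintype.card K := by
    rw [card_eq_sq (F := F) (K := K) hK]
    exact lt_self_pow₀ Fintype.one_lt_card (by norm_num)
  obtain ⟨x, y, hxy, h⟩ := Fintype.exists_ne_map_eq_of_card_lt (Algebra.trace F K) hlt
  refine ⟨(x - y) / c, div_ne_zero (sub_ne_zero.2 hxy) hc, ?_⟩
  rw [div_mul_cancel₀ _ hc, map_sub, h, sub_self]

/-- The kernel of a nonzero trace functional is spanned by any of its nonzero elements. -/
theorem eq_smul_of_trace_mul_eq_zero (hK : Module.finrank F K = 2) {ν c μ x : K} (hν : ν ≠ 0)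
    (hc : Algebra.trace F K (ν * c) = 0) (hμ : Algebra.trace F K (μ * c) = 1)
    (hx : Algebra.trace F K (ν * x) = 0) :
    x = Algebra.trace F K (μ * x) • c := by
  have hc0 : c ≠ 0 := by rintro rfl; simp at hμ
  have : FiniteDimensional F K := Module.finite_of_finrank_eq_succ hK
  set φ : K →ₗ[F] F := (Algebra.trace F K).comp (LinearMap.mulLeft F ν) with hφ
  have hφ0 : φ ≠ 0 := by
    intro h
    exact hν (eq_zero_of_trace_mul_eq_zero (F := F) fun y => LinearMap.congr_fun h y)
  have hrank := φ.finrank_range_add_finrank_ker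
  rw [LinearMap.range_eq_top.2 (LinearMap.surjective hφ0), finrank_top, Module.finrank_self, hK]
    at hrank
  have hker : Module.finrank F (LinearMap.ker φ) = 1 := by omega
  obtain ⟨a, ha⟩ := (finrank_eq_one_iff_of_nonzero' (⟨c, hc⟩ : LinearMap.ker φ)
    fun h => hc0 (congrArg Subtype.val h)).1 hker ⟨x, hx⟩
  have ha' : x = a • c := (congrArg Subtype.val ha).symm
  rw [ha', mul_smul_comm, map_smul, hμ, smul_eq_mul, mul_one]

theorem separatingLeft_traceForm (h2 : (2 : F) ≠ 0) {ν : K} (hν : ν ≠ 0) :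
    (traceForm F ν).polarBilin.SeparatingLeft := by
  intro v h
  have h2' : (2 : K) ≠ 0 := two_ne_zero_of_algebra h2
  have hpol (w : Fin 3 → K) : polar (formB K) v w = 0 := by
    refine (mul_eq_zero.1 (eq_zero_of_trace_mul_eq_zero (F := F)
      (x := ν * polar (formB K) v w) fun y => ?_)).resolve_left hν
    have := h (y • w)
    rw [polarBilin_apply_apply, polar_traceForm, polar_smul_right, smul_eq_mul] at this
    rw [← this]
    congr 1; ring
  have h0 := hpol ![1, 0, 0]
  have h1 := hpol ![0, 1, 0]
  have h3 := hpol ![0, 0, 1]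
  simp [polar_formB] at h0 h1 h3
  ext i; fin_cases i
  · exact h1
  · exact h0
  · exact h3.resolve_left h2'

/-- The constants attached to a nonsquare `c` of `K`: the form `Tr (ν B)` is singular on the
vectors at which `B` takes values in `F c`, and `μ` serves to compute the coordinates on this
line. -/
structure IsTraceData (F : Type*) {K : Type*} [Field F] [Field K] [Algebra F K] (ν μ c : K) :
    Prop where
  two_ne_zero : (2 : F) ≠ 0
  finrank : Module.finrank F K = 2
  ne_zero : ν ≠ 0
  trace_zero : Algebra.trace F K (ν * c) = 0
  trace_one : Algebra.trace F K (μ * c) = 1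
  not_isSquare : ¬ IsSquare c

namespace IsTraceData

variable {ν μ c : K} (D : IsTraceData F ν μ c)
include D

theorem formB_eq {v : Fin 3 → K} (hv : traceForm F ν v = 0) :
    formB K v = traceForm F μ v • c :=
  eq_smul_of_trace_mul_eq_zero D.finrank D.ne_zero D.trace_zero D.trace_one hv

theorem polar_eq {v w : Fin 3 → K} (h : polar (traceForm F ν) v w = 0) :
    polar (formB K) v w = polar (traceForm F μ) v w • c := by
  rw [polar_traceForm] at h ⊢
  exact eq_smul_of_trace_mul_eq_zero D.finrank D.ne_zero D.trace_zero D.trace_one h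

omit [Fintype F] [Fintype K] in
theorem c_ne_zero : c ≠ 0 := by
  have h := D.trace_one
  rintro rfl
  simp at h

theorem formB_eq_zero_iff {v : Fin 3 → K} (hv : traceForm F ν v = 0) :
    formB K v = 0 ↔ traceForm F μ v = 0 := by
  rw [D.formB_eq hv, smul_eq_zero, or_iff_left D.c_ne_zero]

/-- A nonzero multiple of `c` by an element of `F` is not a square, so the tangent of the conic at
a point contains no further singular points outside the conic. -/
theorem exists_smul {u w : Fin 3 → K} (hu0 : u ≠ 0) (hu : formB K u = 0)
    (hw : traceForm F ν w = 0) (h : polar (formB K) u w = 0) : ∃ k : K, w = k • u := by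
  have hsq := isSquare_of_polar_eq_zero hu0 hu h
  refine exists_smul_of_polar_eq_zero hu0 hu ?_ h
  rw [D.formB_eq hw] at hsq ⊢
  by_contra h0
  rw [smul_eq_zero, not_or] at h0
  obtain ⟨d, hd⟩ := isSquare_algebraMap D.two_ne_zero D.finrank (traceForm F μ w)
  obtain ⟨e, he⟩ := hsq
  have hd0 : d ≠ 0 := by
    rintro rfl
    exact h0.1 ((map_eq_zero (algebraMap F K)).1 (hd.trans (mul_zero 0)))
  rw [Algebra.smul_def, hd] at he
  refine D.not_isSquare ⟨e / d, ?_⟩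
  field_simp
  linear_combination he

omit D [Fintype F] in
theorem finrank_span_le (hK : Module.finrank F K = 2) {u : Fin 3 → K} (L : Submodule F (Fin 3 → K))
    (hL : ∀ w ∈ L, ∃ k : K, w = k • u) : Module.finrank F L ≤ 2 := by
  have : FiniteDimensional F K := Module.finite_of_finrank_eq_succ hK
  let φ : K →ₗ[F] (Fin 3 → K) := (LinearMap.toSpanSingleton K _ u).restrictScalars F
  have hle : L ≤ LinearMap.range φ := fun w hw => by
    obtain ⟨k, rfl⟩ := hL w hw
    exact ⟨k, rfl⟩
  calc Module.finrank F L ≤ Module.finrank F (LinearMap.range φ) := Submodule.finrank_mono hle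
    _ ≤ Module.finrank F K := LinearMap.finrank_range_le φ
    _ = 2 := hK

/-- The Witt index of `Tr (ν B)` is at most two. -/
theorem finrank_le_two {L : Submodule F (Fin 3 → K)} (hL : IsTotallySingular (traceForm F ν) L) :
    Module.finrank F L ≤ 2 := by
  by_contra! h3
  have : FiniteDimensional F K := Module.finite_of_finrank_eq_succ D.finrank
  -- On `L` the form `B` is a multiple of a form over `F`, which is isotropic.
  obtain ⟨⟨x, hxL⟩, hx0, hx⟩ := exists_singular (restr (traceForm F μ) L) D.two_ne_zero (by
    rw [Module.card_eq_pow_finrank (K := F) (V := L)]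
    exact Nat.pow_lt_pow_right Fintype.one_lt_card h3)
  replace hx0 : x ≠ 0 := by simpa using hx0
  replace hx : formB K x = 0 := (D.formB_eq_zero_iff (hL x hxL)).2 hx
  have hpolL {y z : Fin 3 → K} (hy : y ∈ L) (hz : z ∈ L) : polar (traceForm F ν) y z = 0 := by
    rw [polar, hL _ (add_mem hy hz), hL y hy, hL z hz]; simp
  -- A vector of `L` orthogonal to `x` for `B` and not in `F x`.
  set φ : L →ₗ[F] F := ((traceForm F μ).polarBilin x).comp L.subtype with hφ
  have hrank := φ.finrank_range_add_finrank_ker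
  have hrange : Module.finrank F (LinearMap.range φ) ≤ 1 := by
    simpa using Submodule.finrank_le (LinearMap.range φ)
  have hex : ∃ y ∈ LinearMap.ker φ, y ∉ Submodule.span F {(⟨x, hxL⟩ : L)} := by
    by_contra! hle
    have h1 := Submodule.finrank_mono (R := F) (s := LinearMap.ker φ) hle
    have h2 : Module.finrank F (Submodule.span F {(⟨x, hxL⟩ : L)}) ≤ 1 :=
      (finrank_span_le_card _).trans (by simp)
    omega
  obtain ⟨⟨y, hyL⟩, hy, hyx⟩ := hex
  have hxy : polar (formB K) x y = 0 := by
    rw [D.polar_eq (hpolL hxL hyL)]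
    have : polar (traceForm F μ) x y = 0 := hy
    rw [this, zero_smul]
  obtain ⟨k, rfl⟩ := D.exists_smul hx0 hx (hL y hyL) hxy
  -- Since `k` is not in `F`, both `p` and `k p` can lie in `F c` only for `p = 0`.
  have hall (z : Fin 3 → K) (hz : z ∈ L) : ∃ k : K, z = k • x := by
    refine D.exists_smul hx0 hx (hL z hz) ?_
    have h1 := D.polar_eq (hpolL hxL hz)
    have h2 := D.polar_eq (hpolL hyL hz)
    rw [polar_smul_left, h1] at h2
    by_contra h0
    rw [h1, smul_eq_zero, not_or] at h0
    refine hyx (Submodule.mem_span_singleton.2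
      ⟨polar (traceForm F μ) (k • x) z / polar (traceForm F μ) x z, Subtype.ext ?_⟩)
    change _ • x = k • x
    rw [← algebraMap_smul K]
    congr 1
    rw [map_div₀, div_eq_iff (by simpa using h0.1)]
    refine mul_right_cancel₀ D.c_ne_zero ?_
    rw [← Algebra.smul_def, ← h2, smul_eq_mul, Algebra.smul_def, mul_assoc]
  have := finrank_span_le D.finrank L hall
  omega

theorem isEllipticSix : IsEllipticSix (traceForm F ν) where
  two_ne_zero := D.two_ne_zero
  sep := separatingLeft_traceForm D.two_ne_zero D.ne_zero
  card := by
    rw [Fintype.card_fun, Fintype.card_fin, card_eq_sq (F := F) D.finrank, ← pow_mul]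
  witt u v w hli hu hv hw huv huw hvw := by
    have hts : IsTotallySingular (traceForm F ν) (Submodule.span F (Set.range ![u, v, w])) := by
      intro z hz
      obtain ⟨g, rfl⟩ := (Submodule.mem_span_range_iff_exists_fun F).1 hz
      simp only [Fin.sum_univ_three, Matrix.cons_val_zero, Matrix.cons_val_one, Matrix.cons_val]
      rw [map_add_eq, map_lin, QuadraticMap.map_smul, polar_add_left, polar_smul_left,
        polar_smul_left, polar_smul_right, polar_smul_right, hu, hv, hw, huv, huw, hvw]
      simp
    have h := D.finrank_le_two hts
    rw [finrank_span_eq_card hli] at h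
    simp at h

theorem isMinusType : IsMinusType (traceForm F ν) := by
  have hsep := separatingLeft_traceForm D.two_ne_zero D.ne_zero
  refine ⟨⟨hsep, fun v h => hsep v fun w => ?_⟩, 2, ?_, ⟨?_, ?_⟩, fun L => D.finrank_le_two⟩
  · have := h w
    rwa [polarBilin_apply_apply, polar_comm] at this
  · have : FiniteDimensional F K := Module.finite_of_finrank_eq_succ D.finrank
    rw [Module.finrank_pi_fintype, Finset.sum_const, D.finrank]
    simp
  · exact (Submodule.span K {![(1 : K), 0, 0]}).restrictScalars F
  · constructor
    · change Module.finrank F (Submodule.span K {![(1 : K), 0, 0]}) = 2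
      rw [← Module.finrank_mul_finrank F K, D.finrank, finrank_span_singleton, mul_one]
      exact fun h => one_ne_zero (α := K) (congrFun h 0)
    · intro v hv
      obtain ⟨k, rfl⟩ := Submodule.mem_span_singleton.1 hv
      rw [traceForm_apply, formB_smul]
      simp [formB_apply]

end IsTraceData

end TraceForm

/-! ### The union of the two orbits is a hemisystem -/

section Lines
open scoped Classical

variable {F K : Type*} [Field F] [Field K] [Algebra F K] [Fintype F] [Fintype K]

/-- If `1` and `k` are independent over `F`, the square classes of the vectors in the `F`-span of
`u` and `k u` cancel. -/
theorem sum_tau_eq_zero (h2 : (2 : F) ≠ 0) (hK : Module.finrank F K = 2) {u : Fin 3 → K} {k : K}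
    (h : LinearIndependent F ![u, k • u]) :
    ∑ a : F, ∑ b : F, tau (a • u + b • k • u) = 0 := by
  have hinj : Function.Injective fun p : F × F => algebraMap F K p.1 + algebraMap F K p.2 * k := by
    rintro ⟨a, b⟩ ⟨a', b'⟩ hp
    simp only at hp
    have := LinearIndependent.pair_iff.1 h (a - a') (b - b') (by
      rw [← algebraMap_smul K, ← algebraMap_smul K (b - b'), smul_smul, ← add_smul,
        map_sub, map_sub]
      convert zero_smul K u
      linear_combination hp)
    exact Prod.ext (sub_eq_zero.1 this.1) (sub_eq_zero.1 this.2)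
  have hbij := (Fintype.bijective_iff_injective_and_card _).2
    ⟨hinj, by rw [Fintype.card_prod, card_eq_sq (F := F) hK, _root_.sq]⟩
  have hsum := (Equiv.ofBijective _ hbij).sum_comp fun z : K => quadraticChar K z * tau u
  have hzero : ∑ z : K, quadraticChar K z * tau u = 0 := by
    rw [← Finset.sum_mul, quadraticChar_sum_zero
      (ringChar_ne_two_of_two_ne_zero (two_ne_zero_of_algebra h2)), zero_mul]
  rw [hzero, Fintype.sum_prod_type] at hsum
  refine (Finset.sum_congr rfl fun a _ => Finset.sum_congr rfl fun b _ => ?_).trans hsum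
  rw [Equiv.ofBijective_apply, ← tau_smul, add_smul, mul_smul, algebraMap_smul, algebraMap_smul]

namespace IsTraceData

variable {ν μ ε : K} (D : IsTraceData F ν μ (ε ^ 2 + 1))
include D

omit [Fintype F] [Fintype K] in
theorem two_ne_zero_extension : (2 : K) ≠ 0 := two_ne_zero_of_algebra D.two_ne_zero

theorem isSquare_neg_one : IsSquare (-1 : K) :=
  CPHemisystem.isSquare_neg_one D.two_ne_zero D.finrank

theorem mk_mem_orbitUnion {v : Fin 3 → K} (hv : v ≠ 0) :
    Projectivization.mk F v hv ∈ orbitUnion F ε ↔ (formB K v = 0 ∧ tau v = 1) ∨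
      ∃ a : F, a ≠ 0 ∧ formB K v = algebraMap F K a * algebraMap F K a * (ε ^ 2 + 1) := by
  rw [orbitUnion, Set.mem_union,
    mk_mem_orbit_singular D.two_ne_zero_extension D.isSquare_neg_one
      (isSquare_algebraMap D.two_ne_zero D.finrank) hv,
    mk_mem_orbit_nonsingular D.two_ne_zero_extension D.isSquare_neg_one D.not_isSquare hv]

theorem orbitUnion_subset : orbitUnion F ε ⊆ quadric (traceForm F ν) := by
  intro p hp
  induction p using Projectivization.ind with | h v hv
  rw [mk_mem_quadric, traceForm_apply]
  rcases (D.mk_mem_orbitUnion hv).1 hp with ⟨h, -⟩ | ⟨a, -, h⟩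
  · rw [h, mul_zero, map_zero]
  · have : ν * formB K v = (a * a) • (ν * (ε ^ 2 + 1)) := by
      rw [h, Algebra.smul_def, map_mul]; ring
    rw [this, map_smul, D.trace_zero, smul_zero]

/-- The sign of a singular vector of `Tr (ν B)` with respect to the union of the two orbits. -/
theorem signFun_eq {v : Fin 3 → K} (hv : traceForm F ν v = 0) :
    signFun (traceForm F ν) (orbitUnion F ε) v = quadraticChar F (traceForm F μ v) +
      if traceForm F μ v = 0 then tau v else 0 := by
  by_cases hv0 : v = 0
  · rw [hv0, QuadraticMap.map_zero, tau_zero]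
    simp [signFun, indicator]
  rw [signFun, Set.inter_eq_left.2 D.orbitUnion_subset, indicator_of_ne_zero _ hv0,
    indicator_of_ne_zero _ hv0, if_pos ((mk_mem_quadric hv0).2 hv)]
  have hB := D.formB_eq hv
  have hmem := D.mk_mem_orbitUnion hv0
  by_cases hf : traceForm F μ v = 0
  · have hB0 : formB K v = 0 := by rw [hB, hf, zero_smul]
    have hno : ¬ ∃ a : F, a ≠ 0 ∧
        formB K v = algebraMap F K a * algebraMap F K a * (ε ^ 2 + 1) := by
      rintro ⟨a, ha, h⟩
      rw [hB0] at h
      have ha' : algebraMap F K a ≠ 0 := by simpa using ha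
      exact mul_ne_zero (mul_ne_zero ha' ha') D.c_ne_zero h.symm
    rw [or_iff_left hno, and_iff_right hB0] at hmem
    rw [if_pos hf, hf, quadraticChar_zero, zero_add]
    rcases tau_eq_or hv0 hB0 with h | h <;> simp [hmem, h]
  · have hB0 : formB K v ≠ 0 := by
      rw [hB, smul_ne_zero_iff]; exact ⟨hf, D.c_ne_zero⟩
    have hsq : (∃ a : F, a ≠ 0 ∧ formB K v = algebraMap F K a * algebraMap F K a * (ε ^ 2 + 1)) ↔
        IsSquare (traceForm F μ v) := by
      rw [hB, Algebra.smul_def]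
      constructor
      · rintro ⟨a, -, h⟩
        refine ⟨a, (algebraMap F K).injective ?_⟩
        rw [map_mul]
        exact mul_right_cancel₀ D.c_ne_zero h
      · rintro ⟨a, h⟩
        refine ⟨a, ?_, by rw [h, map_mul]⟩
        rintro rfl
        exact hf (h.trans (mul_zero 0))
    rw [or_iff_right fun h => hB0 h.1, hsq, ← quadraticChar_one_iff_isSquare hf] at hmem
    rw [if_neg hf, add_zero]
    rcases quadraticChar_dichotomy hf with h | h <;> rw [h] at hmem ⊢ <;> simp [hmem]

/-- Every line of the quadric has half of its points in the union of the two orbits. -/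
theorem two_mul_ncard_line (L : Submodule F (Fin 3 → K)) (hL : IsLine L)
    (hts : IsTotallySingular (traceForm F ν) L) :
    2 * (orbitUnion F ε ∩ pointsOn L).ncard = Nat.card F + 1 := by
  have hpolL {y z : Fin 3 → K} (hy : y ∈ L) (hz : z ∈ L) : polar (traceForm F ν) y z = 0 := by
    rw [polar, hts _ (add_mem hy hz), hts y hy, hts z hz]; simp
  suffices h : ∃ u ∈ L, ∃ w ∈ L, LinearIndependent F ![u, w] ∧
      ∑ a : F, ∑ b : F, (quadraticChar F (traceForm F μ (a • u + b • w)) +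
        if traceForm F μ (a • u + b • w) = 0 then tau (a • u + b • w) else 0) = 0 by
    obtain ⟨u, hu, w, hw, hli, hsum⟩ := h
    rw [hL.eq_span hu hw hli]
    refine (sum_signFun_span_pair hli (hts u hu) (hts w hw) (hpolL hu hw)).1 ?_
    exact (Finset.sum_congr rfl fun a _ => Finset.sum_congr rfl fun b _ =>
      D.signFun_eq (hts _ (add_mem (L.smul_mem a hu) (L.smul_mem b hw)))).trans hsum
  obtain ⟨u₀, w₀, hli₀, hL₀⟩ := hL.exists_span
  have hu₀ : u₀ ∈ L := by rw [hL₀]; exact Submodule.mem_span_of_mem (by simp)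
  have hw₀ : w₀ ∈ L := by rw [hL₀]; exact Submodule.mem_span_of_mem (by simp)
  have hu₀0 : u₀ ≠ 0 := hli₀.ne_zero 0
  by_cases hsing : ∃ u ∈ L, u ≠ 0 ∧ formB K u = 0
  · obtain ⟨u, hu, hu0, hB⟩ := hsing
    have hfu : traceForm F μ u = 0 := (D.formB_eq_zero_iff (hts u hu)).1 hB
    by_cases hpol : ∃ w ∈ L, polar (formB K) u w ≠ 0
    · -- The line has exactly two points on `B = 0`, of different square classes.
      obtain ⟨w₁, hw₁, hpol₁⟩ := hpol
      have hf₁ : polar (traceForm F μ) u w₁ ≠ 0 := by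
        intro h0
        rw [D.polar_eq (hpolL hu hw₁), h0, zero_smul] at hpol₁
        exact hpol₁ rfl
      obtain ⟨a₁, b₁, hfw, huw⟩ := exists_hyperbolic_combination hfu hf₁
      set w := a₁ • w₁ + b₁ • u with hw
      have hwL : w ∈ L := add_mem (L.smul_mem _ hw₁) (L.smul_mem _ hu)
      have hBw : formB K w = 0 := (D.formB_eq_zero_iff (hts w hwL)).2 hfw
      have hBuw : polar (formB K) u w = ε ^ 2 + 1 := by
        rw [D.polar_eq (hpolL hu hwL), huw, one_smul]
      have hlin (a b : F) : traceForm F μ (a • u + b • w) = a * b := by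
        rw [map_lin, hfu, hfw, huw]; ring
      refine ⟨u, hu, w, hwL, ?_, ?_⟩
      · rw [LinearIndependent.pair_iff' hu0]
        rintro a ha
        rw [← ha, polar_smul_right, polar_self_of_singular hfu, smul_zero] at huw
        exact zero_ne_one huw
      have hτ : tau u * tau w = -1 := by
        rw [← quadraticChar_polar D.isSquare_neg_one hB hBw (by rw [hBuw]; exact D.c_ne_zero), hBuw,
          quadraticChar_neg_one_iff_not_isSquare.2 D.not_isSquare]
      have hw0 : w ≠ 0 := by
        intro h0
        rw [h0, tau_zero, mul_zero] at hτ
        norm_num at hτ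
      have hτ' : tau w = - tau u := by
        rcases tau_eq_or hu0 hB with h1 | h1 <;> rcases tau_eq_or hw0 hBw with h3 | h3 <;>
          simp [h1, h3] at hτ ⊢
      have hF : ∀ a : F, a ≠ 0 → ∀ v : Fin 3 → K, tau (a • v) = tau v := by
        intro a ha v
        rw [← algebraMap_smul K, tau_smul, (quadraticChar_one_iff_isSquare (by simpa using ha)).2
          (isSquare_algebraMap D.two_ne_zero D.finrank a), one_mul]
      have hanti (a b : F) (hab : a * b = 0) :
          tau (a • u + b • w) = - tau (b • u + a • w) := by
        rcases mul_eq_zero.1 hab with rfl | rfl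
        · by_cases hb : b = 0
          · simp [hb, tau_zero]
          · simp [hF b hb, hτ']
        · by_cases ha : a = 0
          · simp [ha, tau_zero]
          · simp [hF a ha, hτ']
      simp_rw [hlin, Finset.sum_add_distrib]
      have e1 : ∑ a : F, ∑ b : F, quadraticChar F (a * b) = 0 := by
        simp_rw [map_mul, ← Finset.mul_sum, quadraticChar_sum_zero
          (ringChar_ne_two_of_two_ne_zero D.two_ne_zero), mul_zero, Finset.sum_const_zero]
      have e2 : ∑ a : F, ∑ b : F, (if a * b = 0 then tau (a • u + b • w) else 0) =
          - ∑ a : F, ∑ b : F, (if a * b = 0 then tau (a • u + b • w) else 0) := by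
        conv_rhs => rw [Finset.sum_comm]
        simp_rw [← Finset.sum_neg_distrib]
        refine Finset.sum_congr rfl fun a _ => Finset.sum_congr rfl fun b _ => ?_
        rw [mul_comm b a]
        split_ifs with h
        · exact hanti a b h
        · simp
      rw [e1]
      omega
    · -- The line is a point of the plane over `K`.
      push Not at hpol
      have hall (w : Fin 3 → K) (hw : w ∈ L) : ∃ k : K, w = k • u :=
        D.exists_smul hu0 hB (hts w hw) (hpol w hw)
      obtain ⟨w, hw, hli⟩ : ∃ w ∈ L, LinearIndependent F ![u, w] := by
        by_contra! hno
        have h1 : Module.finrank F L ≤ 1 := by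
          refine (Submodule.finrank_mono (t := Submodule.span F {u}) fun w hw => ?_).trans
            ((finrank_span_le_card _).trans (by simp))
          have := hno w hw
          rw [LinearIndependent.pair_iff' hu0] at this
          push Not at this
          exact Submodule.mem_span_singleton.2 this
        have h3 : Module.finrank F L = 2 := hL
        omega
      obtain ⟨k, rfl⟩ := hall w hw
      refine ⟨u, hu, k • u, hw, hli, ?_⟩
      refine (Finset.sum_congr rfl fun a _ => Finset.sum_congr rfl fun b _ => ?_).trans
        (sum_tau_eq_zero D.two_ne_zero D.finrank hli)
      have hmem : a • u + b • k • u ∈ L := add_mem (L.smul_mem a hu) (L.smul_mem b hw)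
      obtain ⟨k', hk'⟩ := hall _ hmem
      have h0 : traceForm F μ (a • u + b • k • u) = 0 := by
        rw [← D.formB_eq_zero_iff (hts _ hmem), hk', formB_smul, hB, mul_zero]
      rw [h0, quadraticChar_zero, if_pos rfl, zero_add]
  · -- The line has no points on `B = 0`, and `B` is anisotropic on it.
    push Not at hsing
    have hf {v : Fin 3 → K} (hv : v ∈ L) (hv0 : v ≠ 0) : traceForm F μ v ≠ 0 := fun h =>
      hsing v hv hv0 ((D.formB_eq_zero_iff (hts v hv)).2 h)
    have hself : polar (traceForm F μ) u₀ u₀ ≠ 0 := by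
      rw [polar_self]
      simpa [D.two_ne_zero] using hf hu₀ hu₀0
    set t := polar (traceForm F μ) u₀ w₀ / polar (traceForm F μ) u₀ u₀ with ht
    set w := w₀ - t • u₀ with hw
    have hwL : w ∈ L := sub_mem hw₀ (L.smul_mem t hu₀)
    have hli : LinearIndependent F ![u₀, w] := by
      rw [LinearIndependent.pair_iff' hu₀0]
      rintro a ha
      refine (LinearIndependent.pair_iff' hu₀0).1 hli₀ (a + t) ?_
      rw [add_smul, ha, hw, sub_add_cancel]
    have hpol : polar (traceForm F μ) u₀ w = 0 := by
      rw [hw, polar_sub_right, polar_smul_right, ht, smul_eq_mul, div_mul_cancel₀ _ hself, sub_self]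
    have hw0 : w ≠ 0 := hli.ne_zero 1
    refine ⟨u₀, hu₀, w, hwL, hli, ?_⟩
    refine (Finset.sum_congr rfl fun a _ => Finset.sum_congr rfl fun b _ => ?_).trans
      (sum_quadraticChar_diagonal D.two_ne_zero (hf hu₀ hu₀0) (hf hwL hw0))
    have hlin : traceForm F μ (a • u₀ + b • w) =
        a * a * traceForm F μ u₀ + b * b * traceForm F μ w := by
      rw [map_lin, hpol, mul_zero, add_zero]
    rw [← hlin]
    split_ifs with h
    · have h0 : a • u₀ + b • w = 0 := by
        by_contra h0
        exact hf (add_mem (L.smul_mem a hu₀) (L.smul_mem b hwL)) h0 h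
      rw [h0, tau_zero, add_zero]
    · rw [add_zero]

omit D [Fintype F] [Fintype K] in
theorem smul_mem_orbitUnion (g : omegaThree K) {p : ℙ F (Fin 3 → K)} (hp : p ∈ orbitUnion F ε) :
    g • p ∈ orbitUnion F ε := by
  rcases hp with h | h
  · exact Or.inl ((MulAction.mem_orbit_of_mem_orbit g) h)
  · exact Or.inr ((MulAction.mem_orbit_of_mem_orbit g) h)

theorem isCossidentePenttila : IsCossidentePenttila F ν (orbitUnion F ε) where
  minus := D.isMinusType
  hemisystem := isHemisystem_of_line D.isEllipticSix D.orbitUnion_subset D.two_mul_ncard_line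
  invariant g _ hp := smul_mem_orbitUnion g hp

end IsTraceData

end Lines

end CPHemisystem
end

theorem mainTheorem2 (F K : Type*) [Field F] [Finite F] [Field K] [Finite K] [Algebra F K]
    (q : ℕ) (hq : Nat.card F = q) (hodd : Odd q) (hK : Module.finrank F K = 2) :
    CPHemisystem.quadric (CPHemisystem.formB K) = CPHemisystem.conic K ∧
    (∀ ε : K, CPHemisystem.point K 1 ε ∈ CPHemisystem.evenPoints K ↔ ¬ IsSquare (ε ^ 2 + 1)) ∧
    (∃ ε : K, ε ≠ 0 ∧ ¬ IsSquare (ε ^ 2 + 1)) ∧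
    ∀ ε : K, ¬ IsSquare (ε ^ 2 + 1) →
      MulAction.orbit (CPHemisystem.omegaThree K) (CPHemisystem.point K (0 : K) 0) =
        CPHemisystem.conic K ∧
      MulAction.orbit (CPHemisystem.omegaThree K) (CPHemisystem.point K 1 ε) =
        CPHemisystem.evenPoints K ∧
      (∃ ν : K, ν ≠ 0 ∧ CPHemisystem.traceForm F ν ![1, 1, ε] = 0) ∧
      ∀ ν : K, ν ≠ 0 → CPHemisystem.traceForm F ν ![1, 1, ε] = 0 →
        (∀ g ∈ CPHemisystem.omegaThree K,
          g.restrictScalars F ∈ CPHemisystem.orthogonalGroup (CPHemisystem.traceForm F ν)) ∧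
        CPHemisystem.IsCossidentePenttila F ν (CPHemisystem.orbitUnion F ε) ∧
        CPHemisystem.IsStronglyRegular
          ((CPHemisystem.collinearityGraph (CPHemisystem.traceForm F ν)).induce
            (CPHemisystem.orbitUnion F ε))
          ((q ^ 3 + 1) * (q + 1) / 2) ((q ^ 2 + 1) * (q - 1) / 2)
          ((q - 3) / 2) ((q - 1) ^ 2 / 2) := by
  have := Fintype.ofFinite F
  have := Fintype.ofFinite K
  rw [Nat.card_eq_fintype_card] at hq
  subst hq
  have h2 : (2 : F) ≠ 0 := CPHemisystem.two_ne_zero_of_odd hodd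
  have h2' : (2 : K) ≠ 0 := CPHemisystem.two_ne_zero_of_algebra h2
  have hneg : IsSquare (-1 : K) := CPHemisystem.isSquare_neg_one h2 hK
  have hB (ε : K) : CPHemisystem.formB K ![1, 1, ε] = ε ^ 2 + 1 := by
    simp [CPHemisystem.formB_apply]; ring
  refine ⟨CPHemisystem.quadric_formB, fun ε => ?_, CPHemisystem.exists_sq_add_one_not_isSquare h2',
    fun ε hε => ⟨CPHemisystem.orbit_eq_conic h2' hneg,
      CPHemisystem.orbit_eq_evenPoints h2' hneg hε, ?_, fun ν hν hν0 => ?_⟩⟩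
  · rw [CPHemisystem.point, CPHemisystem.mk_mem_evenPoints, hB]
  · have hc : ε ^ 2 + 1 ≠ 0 := fun h => hε ⟨0, by rw [h, mul_zero]⟩
    obtain ⟨ν, hν, h⟩ := CPHemisystem.exists_trace_mul_eq_zero (F := F) hK hc
    exact ⟨ν, hν, by rw [CPHemisystem.traceForm_apply, hB, h]⟩
  · have hc : ε ^ 2 + 1 ≠ 0 := fun h => hε ⟨0, by rw [h, mul_zero]⟩
    obtain ⟨μ, hμ⟩ := CPHemisystem.exists_trace_mul_eq_one (F := F) hc
    rw [CPHemisystem.traceForm_apply, hB] at hν0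
    have D : CPHemisystem.IsTraceData F ν μ (ε ^ 2 + 1) := ⟨h2, hK, hν, hν0, hμ, hε⟩
    refine ⟨fun g hg v => ?_, D.isCossidentePenttila, ?_⟩
    · change CPHemisystem.traceForm F ν (g v) = _
      rw [CPHemisystem.traceForm_apply, CPHemisystem.formB_omegaThree hg,
        CPHemisystem.traceForm_apply]
    · have hq : 3 ≤ Fintype.card F := by
        have h1 : 1 < Fintype.card F := Fintype.one_lt_card
        obtain ⟨n, hn⟩ := hodd
        omega
      exact CPHemisystem.isStronglyRegular_of_line D.isEllipticSix D.orbitUnion_subset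
        D.two_mul_ncard_line hq
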